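/- Let $q>3$ be an odd prime power. Let $h(x,y)=x_0y_0^q+x_1y_1^q+x_2y_2^q$ be the standard Hermitian form on $\mathbb F_{q^2}^3$, and let $U$ be the set of the $q^3+1$ isotropic points $\langle x\rangle$ (those with $h(x,x)=0$) of the projective plane over $\mathbb F_{q^2}$. Taylor's two-graph for $U(3,q)$ is the set of all triples $\{\langle x\rangle,\langle y\rangle,\langle z\rangle\}$ of distinct points of $U$, called coherent, for which $h(x,y)h(y,z)h(z,x)$ is a square in $\mathbb F_{q^2}$ if $q\equiv 3 \pmod 4$, respectively a non-square if $q\equiv 1\pmod 4$. Let $\Gamma$ be any Taylor graph for $U(3,q)$, that is, any graph with vertex set $U$ such that * three distinct vertices form a coherent triple if and only if they span an odd number of edges of $\Gamma$ (so $\Gamma$ lies in the switching class of Taylor's two-graph), and * $\Gamma$ is regular of degree $\tfrac12 q(q^2+1)$ (these are the strongly regular graphs in that switching class with $v=(q+1)(q^2-q+1)$, $e^+=\frac{q-1}{2}$, $e^-=-\frac{q^2+1}{2}$, $m^-=q^2-q+1$). Then $\Gamma$ has no Delsarte coclique, where a Delsarte coclique of a $k$-regular graph on $v$ vertices with smallest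 adjacency eigenvalue $e^-$ is an independent set of size $\frac{ve^-}{e^--k}$. -/

import Mathlib

open scoped LinearAlgebra.Projectivization

noncomputable section

/-- The standard Hermitian form `x₀ y₀^q + x₁ y₁^q + x₂ y₂^q` on `F³`, where `F` is a field with
`q²` elements (so that `a ↦ a^q` is the involution of `F` over its subfield with `q` elements). -/
def hermForm {F : Type*} [Field F] (q : ℕ) (x y : Fin 3 → F) : F :=
  ∑ i, x i * y i ^ q

/-- The points of the Hermitian unital, i.e. the isotropic points of the projective plane over `F`
with respect to the Hermitian form (the condition does not depend on the representative, since
`hermForm q (c • x) (c • x) = c ^ (q + 1) * hermForm q x x`). These are the `q³ + 1` points on which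
the group `U(3,q)` acts. -/
abbrev UnitalPoint (q : ℕ) (F : Type*) [Field F] : Type _ :=
  {P : ℙ F (Fin 3 → F) // hermForm q P.rep P.rep = 0}

instance UnitalPoint.fintype (q : ℕ) (F : Type*) [Field F] [Finite F] :
    Fintype (UnitalPoint q F) :=
  Fintype.ofFinite _

/-- The coherent triples of Taylor's (unitary) two-graph for `U(3,q)`, `q` odd: a triple of distinct
isotropic points `⟨x⟩, ⟨y⟩, ⟨z⟩` is coherent when `h(x,y) h(y,z) h(z,x)` is a square in the field
with `q²` elements, if `q ≡ 3 (mod 4)`, and when it is a non-square, if `q ≡ 1 (mod 4)`.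
Neither the choice of representatives nor the order of the three points matters: rescaling `x` by
`c` multiplies the product by the square `c ^ (q + 1)`, and a transposition of the points raises the
product to the power `q`. The relation is only used for pairwise distinct points. -/
def TaylorCoherent {q : ℕ} {F : Type*} [Field F] (x y z : UnitalPoint q F) : Prop :=
  IsSquare (hermForm q x.1.rep y.1.rep * hermForm q y.1.rep z.1.rep * hermForm q z.1.rep x.1.rep)
    ↔ q % 4 = 3

/-- For distinct `x, y, z`: the number of edges of `Γ` inside `{x, y, z}` is odd. The set of all
such triples is the two-graph associated with `Γ`. -/
def OddTriple {V : Type*} (Γ : SimpleGraph V) (x y z : V) : Prop :=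
  Odd (({s(x, y), s(y, z), s(z, x)} ∩ Γ.edgeSet : Set (Sym2 V)).ncard)

open Classical in
/-- `Γ` is a Taylor graph for `U(3,q)`: it is a graph on the points of the unital which belongs to
the switching class of Taylor's two-graph (the coherent triples are those that contain an odd number
of edges of `Γ`) and which is regular of degree `q (q² + 1) / 2`.
Such a graph is strongly regular with `v = (q + 1)(q² - q + 1)`, `e⁺ = (q - 1)/2`,
`e⁻ = -(q² + 1)/2` and `m⁻ = q² - q + 1`. -/
structure IsTaylorGraph (q : ℕ) (F : Type*) [Field F] [Finite F]
    (Γ : SimpleGraph (UnitalPoint q F)) : Prop where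
  twoGraph_eq : ∀ x y z : UnitalPoint q F, x ≠ y → y ≠ z → z ≠ x →
    (OddTriple Γ x y z ↔ TaylorCoherent x y z)
  regular : Γ.IsRegularOfDegree (q * (q ^ 2 + 1) / 2)

open Classical in
/-- A Delsarte coclique of a finite regular graph `Γ` with `v` vertices, degree `k` and smallest
adjacency eigenvalue `e`: an independent set of size `v e / (e - k)`, i.e. one that meets Hoffman's
ratio bound. -/
def IsDelsarteCoclique {V : Type*} [Fintype V] (Γ : SimpleGraph V) (Y : Finset V) : Prop :=
  Γ.IsIndepSet (Y : Set V) ∧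
    ∃ (k : ℕ) (e : ℝ), Γ.IsRegularOfDegree k ∧
      IsLeast {t : ℝ | Module.End.HasEigenvalue (Matrix.toLin' (Γ.adjMatrix ℝ)) t} e ∧
      (Y.card : ℝ) = Fintype.card V * e / (e - k)

end

/-! Hoffman's bound for Γ is q² - q + 1, and an independent set contains no coherent triple. So it
suffices that a set of unital points without coherent triples has fewer than q² - q + 1 elements
(`card_lt_of_not_coherent`). This is a rank argument in the characteristic p of F.

Write q = p^e, p = 2m + 1, and N(x,y) = h(x,y)^((q² - 1)/2), the quadratic character with values in
F. On a set without coherent triples, minus one of its points, N is ±(J - I) up to switching. If the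
set had q² - q + 1 points, the remaining order q² - q would be divisible by p, and J - I would be
invertible (`card_le_of_factorization`). So N would have rank at least q² - q.

On the other hand (q² - 1)/2 = (q + 1) m (1 + p + ... + p^(e-1)), so N is an entrywise product of e
Frobenius twists of (h h^q)^m. The latter is the value at ξ = x^q, η = y^q of (x·η)^m (ξ·y)^m, which
is harmonic of bidegree (m,m) in (x,ξ). Such polynomials form a space of dimension at most (m+1)³.
Because p = 2m + 1, it contains the products of ∑ xᵢξᵢ with the harmonic polynomials of bidegree
(m-1,m-1), a space of dimension at least m³ that vanishes at isotropic points. Hence one factor has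
rank at most (m+1)³ - m³ = 3m² + 3m + 1, and the e-th power of this is less than q² - q when q > 3.

The eigenvalue in Hoffman's bound comes from the regularity of the two-graph: the Seidel matrix S
satisfies (S - q²)(S + q) = 0, and a column of S + q is an eigenvector of Γ
(`IsTaylorGraph.hasEigenvalue`). -/

noncomputable section

/-! ### Harmonic polynomials in two dual sets of three variables -/

section Harmonic

open MvPolynomial

/-- The exponents in two sets of three variables that have degree `d` in each of the two sets. -/
def bidegExps (d : ℕ) : Finset (Fin 3 ⊕ Fin 3 →₀ ℕ) :=
  ((Finset.univ.finsuppAntidiag d) ×ˢ (Finset.univ.finsuppAntidiag d)).map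
    Finsupp.sumFinsuppEquivProdFinsupp.symm.toEmbedding

theorem mem_bidegExps {d : ℕ} {s : Fin 3 ⊕ Fin 3 →₀ ℕ} :
    s ∈ bidegExps d ↔ ∑ i, s (Sum.inl i) = d ∧ ∑ i, s (Sum.inr i) = d := by
  rw [bidegExps, Finset.mem_map_equiv]
  simp only [Equiv.symm_symm, Finset.mem_product, Finset.mem_finsuppAntidiag,
    Finset.subset_univ, and_true]
  rfl

theorem four_mul_card_bidegExps (d : ℕ) : 4 * (bidegExps d).card = ((d + 1) * (d + 2)) ^ 2 := by
  have h2 : (3 + d - 1).choose d = (d + 2).choose 2 := by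
    rw [show 3 + d - 1 = d + 2 by omega, ← Nat.choose_symm_add]
  have h : 2 * (d + 2).choose 2 = (d + 1) * (d + 2) := by
    have := Nat.triangle_succ (d + 1)
    rw [Nat.choose_two_right]
    rw [Nat.mul_div_cancel' (Nat.even_mul_pred_self (d + 2)).two_dvd]
    simp [mul_comm]
  rw [bidegExps, Finset.card_map, Finset.card_product, Finset.card_finsuppAntidiag_nat_eq_choose,
    Finset.card_univ, Fintype.card_fin, h2, ← h]
  ring

/-- The bidegrees of the variables. -/
def bidegWeight : Fin 3 ⊕ Fin 3 → ℕ × ℕ := Sum.elim (fun _ => (1, 0)) (fun _ => (0, 1))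

theorem weight_bidegWeight (s : Fin 3 ⊕ Fin 3 →₀ ℕ) :
    Finsupp.weight bidegWeight s = (∑ i, s (Sum.inl i), ∑ i, s (Sum.inr i)) := by
  rw [Finsupp.weight_apply, Finsupp.sum_fintype _ _ (by simp)]
  simp [bidegWeight, Fintype.sum_sum_type, Prod.ext_iff, Prod.fst_sum, Prod.snd_sum]

/-! ### Bihomogeneous and harmonic polynomials, and their dimensions. -/

variable (F : Type*) [Field F]

/-- The polynomials that are homogeneous of degree `d` in each of the two sets of variables. -/
def bihomSubmodule (d : ℕ) : Submodule F (MvPolynomial (Fin 3 ⊕ Fin 3) F) :=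
  weightedHomogeneousSubmodule F bidegWeight (d, d)

variable {F}

theorem mem_bihomSubmodule {d : ℕ} {p : MvPolynomial (Fin 3 ⊕ Fin 3) F} :
    p ∈ bihomSubmodule F d ↔ ∀ s, coeff s p ≠ 0 → s ∈ bidegExps d := by
  rw [bihomSubmodule, mem_weightedHomogeneousSubmodule, IsWeightedHomogeneous]
  simp only [weight_bidegWeight, mem_bidegExps, Prod.mk.injEq]

variable (F) in
/-- A bihomogeneous polynomial is given by its coefficients. -/
def bihomEquiv (d : ℕ) : bihomSubmodule F d ≃ₗ[F] (bidegExps d → F) :=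
  LinearEquiv.ofBijective
    ({ toFun := fun p s => coeff s.1 p.1
       map_add' := fun p r => by ext s; simp
       map_smul' := fun c p => by ext s; simp } : bihomSubmodule F d →ₗ[F] (bidegExps d → F)) <| by
    refine ⟨(injective_iff_map_eq_zero _).2 fun p hp => ?_, fun c => ?_⟩
    · ext s
      by_contra h
      exact h (congrFun hp ⟨s, mem_bihomSubmodule.1 p.2 s h⟩)
    · classical
      have hc : ∀ s, coeff s (∑ t : bidegExps d, monomial t.1 (c t)) =
          if h : s ∈ bidegExps d then c ⟨s, h⟩ else 0 := by
        intro s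
        simp only [coeff_sum, coeff_monomial]
        split_ifs with h
        · rw [Finset.sum_eq_single ⟨s, h⟩] <;> simp +contextual [Subtype.ext_iff]
        · refine Finset.sum_eq_zero fun t _ => if_neg ?_
          rintro rfl
          exact h t.2
      refine ⟨⟨∑ t : bidegExps d, monomial t.1 (c t), mem_bihomSubmodule.2 fun s hs => ?_⟩, ?_⟩
      · by_contra h
        exact hs (by rw [hc, dif_neg h])
      · ext s
        exact (hc s).trans (dif_pos s.2)

instance bihomSubmodule.finiteDimensional (d : ℕ) : FiniteDimensional F (bihomSubmodule F d) :=
  (bihomEquiv F d).symm.finiteDimensional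

theorem finrank_bihomSubmodule (d : ℕ) :
    Module.finrank F (bihomSubmodule F d) = (bidegExps d).card := by
  rw [(bihomEquiv F d).finrank_eq]
  simp

variable (F) in
/-- The Laplace operator `∑ ∂²/∂xᵢ∂ξᵢ`. -/
def laplace : MvPolynomial (Fin 3 ⊕ Fin 3) F →ₗ[F] MvPolynomial (Fin 3 ⊕ Fin 3) F :=
  ∑ i : Fin 3, (pderiv (Sum.inl i)).toLinearMap ∘ₗ (pderiv (Sum.inr i)).toLinearMap

theorem laplace_apply (p : MvPolynomial (Fin 3 ⊕ Fin 3) F) :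
    laplace F p = ∑ i : Fin 3, pderiv (Sum.inl i) (pderiv (Sum.inr i) p) := by
  simp [laplace]

theorem laplace_mem {d : ℕ} {p : MvPolynomial (Fin 3 ⊕ Fin 3) F}
    (hp : p ∈ bihomSubmodule F (d + 1)) : laplace F p ∈ bihomSubmodule F d := by
  rw [laplace_apply]
  refine Submodule.sum_mem _ fun i _ => ?_
  rw [bihomSubmodule, mem_weightedHomogeneousSubmodule] at hp ⊢
  have h1 : IsWeightedHomogeneous bidegWeight (pderiv (Sum.inr i) p) (d + 1, d) :=
    hp.pderiv (by simp [bidegWeight])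
  exact h1.pderiv (by simp [bidegWeight])

variable (F) in
/-- The harmonic polynomials of degree `d` in each of the two sets of variables. -/
def harmonicSubmodule (d : ℕ) : Submodule F (MvPolynomial (Fin 3 ⊕ Fin 3) F) :=
  bihomSubmodule F d ⊓ LinearMap.ker (laplace F)

instance harmonicSubmodule.finiteDimensional (d : ℕ) :
    FiniteDimensional F (harmonicSubmodule F d) :=
  Submodule.finiteDimensional_inf_left _ _

/-- Rank-nullity for the Laplace operator; surjectivity is not needed, so this holds in every
characteristic. -/
theorem card_bidegExps_le_finrank_harmonicSubmodule (d : ℕ) :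
    (bidegExps (d + 1)).card ≤
      Module.finrank F (harmonicSubmodule F (d + 1)) + (bidegExps d).card := by
  let L : bihomSubmodule F (d + 1) →ₗ[F] bihomSubmodule F d :=
    (laplace F).restrict fun p hp => laplace_mem hp
  have h1 := L.finrank_range_add_finrank_ker
  have h2 : Module.finrank F (LinearMap.range L) ≤ (bidegExps d).card :=
    (Submodule.finrank_le _).trans (finrank_bihomSubmodule d).le
  have h3 : Module.finrank F (LinearMap.ker L) ≤
      Module.finrank F (harmonicSubmodule F (d + 1)) := by
    let J : LinearMap.ker L →ₗ[F] harmonicSubmodule F (d + 1) :=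
      ((bihomSubmodule F (d + 1)).subtype ∘ₗ (LinearMap.ker L).subtype).codRestrict _ fun p =>
        ⟨p.1.2, congrArg Subtype.val p.2⟩
    refine LinearMap.finrank_le_finrank_of_injective (f := J) fun a b hab => ?_
    exact Subtype.ext (Subtype.ext (congrArg (fun z => z.1) hab))
  rw [finrank_bihomSubmodule] at h1
  omega

/-- The squares of consecutive triangular numbers differ by a cube. -/
theorem cube_le_finrank_harmonicSubmodule (d : ℕ) :
    (d + 1) ^ 3 ≤ Module.finrank F (harmonicSubmodule F d) := by
  cases d with
  | zero =>
    have h : harmonicSubmodule F 0 = bihomSubmodule F 0 := by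
      refine le_antisymm inf_le_left fun p hp => ⟨hp, ?_⟩
      have : p = C (coeff 0 p) := by
        ext s
        rw [coeff_C]
        split_ifs with h
        · rw [h]
        · by_contra h0
          have := mem_bidegExps.1 (mem_bihomSubmodule.1 hp s h0)
          simp only [Finset.sum_eq_zero_iff, Finset.mem_univ, true_implies] at this
          exact h (Finsupp.ext fun i => by rcases i with i | i <;> simp [this])
      rw [SetLike.mem_coe, LinearMap.mem_ker, laplace_apply, this]
      simp
    rw [h, finrank_bihomSubmodule]
    have := four_mul_card_bidegExps 0
    omega
  | succ d =>
    have h1 := card_bidegExps_le_finrank_harmonicSubmodule (F := F) d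
    have h2 := four_mul_card_bidegExps d
    have h3 := four_mul_card_bidegExps (d + 1)
    nlinarith

/-- The exponent of the monomial `xᵢ ξᵢ`. -/
def pairExp (i : Fin 3) : Fin 3 ⊕ Fin 3 →₀ ℕ :=
  Finsupp.single (Sum.inl i) 1 + Finsupp.single (Sum.inr i) 1

theorem coeff_laplace (p : MvPolynomial (Fin 3 ⊕ Fin 3) F) (s : Fin 3 ⊕ Fin 3 →₀ ℕ) :
    coeff s (laplace F p) = ∑ i, coeff (s + pairExp i) p *
      (((s (Sum.inl i) + 1) * (s (Sum.inr i) + 1) : ℕ) : F) := by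
  rw [laplace_apply, coeff_sum]
  refine Finset.sum_congr rfl fun i _ => ?_
  rw [coeff_pderiv, coeff_pderiv, pairExp, ← add_assoc]
  simp
  ring

/-- A harmonic polynomial of small degree is determined by its coefficients at the monomials that
are not divisible by `x₀ ξ₀`. -/
theorem eq_zero_of_harmonic {p m : ℕ} [CharP F p] (hm : m < p)
    {f : MvPolynomial (Fin 3 ⊕ Fin 3) F} (hf : f ∈ harmonicSubmodule F m)
    (h0 : ∀ s ∈ bidegExps m, s (Sum.inl 0) = 0 ∨ s (Sum.inr 0) = 0 → coeff s f = 0) : f = 0 := by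
  have key : ∀ n : ℕ, ∀ s : Fin 3 ⊕ Fin 3 →₀ ℕ, s (Sum.inl 0) = n → coeff s f = 0 := by
    intro n
    induction n with
    | zero =>
      intro s hs
      by_contra h
      exact h (h0 s (mem_bihomSubmodule.1 hf.1 s h) (Or.inl hs))
    | succ n ih =>
      intro s hs
      by_contra h
      have hsm := mem_bihomSubmodule.1 hf.1 s h
      have hr : s (Sum.inr 0) ≠ 0 := fun hr => h (h0 s hsm (Or.inr hr))
      obtain ⟨t, rfl⟩ : ∃ t, s = t + pairExp 0 := by
        refine ⟨s - pairExp 0, (tsub_add_cancel_of_le ?_).symm⟩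
        intro i
        rcases i with i | i <;> fin_cases i <;> simp [pairExp] <;> omega
      -- The other two coefficients in this relation have a smaller exponent of x₀. The factor of
      -- the wanted one is a product of two positive integers ≤ m < p, hence nonzero.
      have hc := coeff_laplace f t
      rw [hf.2, coeff_zero, Fin.sum_univ_three, ih (t + pairExp 1), ih (t + pairExp 2)] at hc
      · rw [zero_mul, zero_mul, add_zero, add_zero, eq_comm, mul_eq_zero] at hc
        have hc := hc.resolve_left h
        obtain ⟨h1, h2⟩ := mem_bidegExps.1 hsm
        simp only [Fin.sum_univ_three, Finsupp.add_apply, pairExp, Finsupp.single_apply] at h1 h2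
        simp at h1 h2
        rw [Nat.cast_mul, mul_eq_zero, CharP.cast_eq_zero_iff F p, CharP.cast_eq_zero_iff F p] at hc
        rcases hc with hc | hc
        · have := Nat.le_of_dvd (by omega) hc
          omega
        · have := Nat.le_of_dvd (by omega) hc
          omega
      · simpa [pairExp] using hs
      · simpa [pairExp] using hs
  ext s
  exact key _ s rfl

/-- The determining coefficients are counted by removing the multiples of x₀ξ₀, which correspond to
the exponents of the next lower bidegree; again a difference of squares of triangular numbers. -/
theorem finrank_harmonicSubmodule_le {p m : ℕ} [CharP F p] (hm : m < p) :
    Module.finrank F (harmonicSubmodule F m) ≤ (m + 1) ^ 3 := by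
  classical
  set B := (bidegExps m).filter fun s => s (Sum.inl 0) = 0 ∨ s (Sum.inr 0) = 0 with hB
  have hle : Module.finrank F (harmonicSubmodule F m) ≤ B.card := by
    let L : harmonicSubmodule F m →ₗ[F] (B → F) :=
      { toFun := fun p s => coeff s.1 p.1
        map_add' := fun p r => by ext s; simp
        map_smul' := fun c p => by ext s; simp }
    have hL : Function.Injective L := by
      refine (injective_iff_map_eq_zero _).2 fun f hf => Subtype.ext ?_
      exact eq_zero_of_harmonic hm f.2 fun s hs h => congrFun hf ⟨s, by simp [hB, hs, h]⟩
    simpa using LinearMap.finrank_le_finrank_of_injective hL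
  refine hle.trans ?_
  cases m with
  | zero =>
    have h1 := four_mul_card_bidegExps 0
    have : B.card ≤ (bidegExps 0).card := Finset.card_filter_le _ _
    omega
  | succ d =>
    have h : ((bidegExps d).map (addRightEmbedding (pairExp 0))) ⊆
        (bidegExps (d + 1)).filter fun s => ¬ (s (Sum.inl 0) = 0 ∨ s (Sum.inr 0) = 0) := by
      intro s hs
      obtain ⟨t, ht, rfl⟩ := Finset.mem_map.1 hs
      rw [mem_bidegExps] at ht
      simp [mem_bidegExps, Fin.sum_univ_three, pairExp] at ht ⊢
      omega
    have h1 := Finset.card_le_card h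
    rw [Finset.card_map] at h1
    have h2 := Finset.card_filter_add_card_filter_not (s := bidegExps (d + 1))
      (fun s => s (Sum.inl 0) = 0 ∨ s (Sum.inr 0) = 0)
    have h3 := four_mul_card_bidegExps d
    have h4 := four_mul_card_bidegExps (d + 1)
    rw [← hB] at h2
    nlinarith

variable (F) in
/-- The quadratic form `∑ xᵢ ξᵢ`. -/
def pairing : MvPolynomial (Fin 3 ⊕ Fin 3) F := ∑ i, X (Sum.inl i) * X (Sum.inr i)

theorem pairing_ne_zero : pairing F ≠ 0 := by
  intro h
  have := congrArg (eval (Sum.elim ![1, 0, 0] ![1, 0, 0] : Fin 3 ⊕ Fin 3 → F)) h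
  simp [pairing, Fin.sum_univ_three] at this

theorem pderiv_inl_pairing (i : Fin 3) :
    pderiv (Sum.inl i) (pairing F) = X (Sum.inr i) := by
  fin_cases i <;> simp [pairing, Fin.sum_univ_three, pderiv_X]

theorem pderiv_inr_pairing (i : Fin 3) :
    pderiv (Sum.inr i) (pairing F) = X (Sum.inl i) := by
  fin_cases i <;> simp [pairing, Fin.sum_univ_three, pderiv_X]

theorem pairing_mul_mem {d : ℕ} {f : MvPolynomial (Fin 3 ⊕ Fin 3) F}
    (hf : f ∈ bihomSubmodule F d) : pairing F * f ∈ bihomSubmodule F (d + 1) := by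
  rw [bihomSubmodule, mem_weightedHomogeneousSubmodule] at hf ⊢
  have h : IsWeightedHomogeneous bidegWeight (pairing F) (1, 1) :=
    IsWeightedHomogeneous.sum _ _ _ fun i _ =>
      (isWeightedHomogeneous_X F bidegWeight (Sum.inl i)).mul
        (isWeightedHomogeneous_X F bidegWeight (Sum.inr i))
  have := h.mul hf
  rwa [Prod.mk_add_mk, add_comm] at this

theorem euler_inl {d : ℕ} {f : MvPolynomial (Fin 3 ⊕ Fin 3) F} (hf : f ∈ bihomSubmodule F d) :
    ∑ i, X (Sum.inl i) * pderiv (Sum.inl i) f = d • f := by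
  have h : IsWeightedHomogeneous (fun i => (bidegWeight i).1) f d := by
    intro s hs
    have := congrArg Prod.fst (weight_bidegWeight s)
    rw [← (mem_bidegExps.1 (mem_bihomSubmodule.1 hf s hs)).1]
    simp [Finsupp.weight_apply, Finsupp.sum_fintype, Fintype.sum_sum_type, bidegWeight]
  simpa [Fintype.sum_sum_type, bidegWeight] using h.sum_weight_X_mul_pderiv

theorem euler_inr {d : ℕ} {f : MvPolynomial (Fin 3 ⊕ Fin 3) F} (hf : f ∈ bihomSubmodule F d) :
    ∑ i, X (Sum.inr i) * pderiv (Sum.inr i) f = d • f := by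
  have h : IsWeightedHomogeneous (fun i => (bidegWeight i).2) f d := by
    intro s hs
    rw [← (mem_bidegExps.1 (mem_bihomSubmodule.1 hf s hs)).2]
    simp [Finsupp.weight_apply, Finsupp.sum_fintype, Fintype.sum_sum_type, bidegWeight]
  simpa [Fintype.sum_sum_type, bidegWeight] using h.sum_weight_X_mul_pderiv

/-- The 3 counts the pairs of variables; the 2d is Euler's identity in each of the two sets. -/
theorem laplace_pairing_mul {d : ℕ} {f : MvPolynomial (Fin 3 ⊕ Fin 3) F}
    (hf : f ∈ bihomSubmodule F d) :
    laplace F (pairing F * f) = ((2 * d + 3 : ℕ) : MvPolynomial (Fin 3 ⊕ Fin 3) F) * f +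
      pairing F * laplace F f := by
  have h1 := euler_inl hf
  have h2 := euler_inr hf
  have h : ∀ i : Fin 3, pderiv (Sum.inl i) (pderiv (Sum.inr i) (pairing F * f)) =
      f + X (Sum.inl i) * pderiv (Sum.inl i) f + X (Sum.inr i) * pderiv (Sum.inr i) f +
        pairing F * pderiv (Sum.inl i) (pderiv (Sum.inr i) f) := by
    intro i
    rw [pderiv_mul, map_add, pderiv_mul, pderiv_mul, pderiv_inl_pairing, pderiv_inr_pairing,
      pderiv_X_self]
    ring
  rw [laplace_apply, laplace_apply, Finset.sum_congr rfl fun i _ => h i, Finset.sum_add_distrib,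
    Finset.sum_add_distrib, Finset.sum_add_distrib, h1, h2, Finset.mul_sum]
  simp
  ring

/-- In characteristic `2 d + 3` the multiples of the quadratic form by harmonic polynomials of
degree `d` are harmonic. -/
theorem pairing_mul_mem_harmonic {d : ℕ} [CharP F (2 * d + 3)]
    {f : MvPolynomial (Fin 3 ⊕ Fin 3) F} (hf : f ∈ harmonicSubmodule F d) :
    pairing F * f ∈ harmonicSubmodule F (d + 1) := by
  refine ⟨pairing_mul_mem hf.1, ?_⟩
  have h0 : laplace F f = 0 := hf.2
  have h1 : ((2 * d + 3 : ℕ) : MvPolynomial (Fin 3 ⊕ Fin 3) F) = 0 := CharP.cast_eq_zero _ _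
  rw [SetLike.mem_coe, LinearMap.mem_ker, laplace_pairing_mul hf.1, h0, h1]
  simp

/-- The polynomial `(x · η)^m (ξ · y)^m`. -/
def zonal (m : ℕ) (v : Fin 3 ⊕ Fin 3 → F) : MvPolynomial (Fin 3 ⊕ Fin 3) F :=
  (∑ i, X (Sum.inl i) * C (v (Sum.inr i))) ^ m * (∑ i, X (Sum.inr i) * C (v (Sum.inl i))) ^ m

theorem zonal_mem {m : ℕ} {v : Fin 3 ⊕ Fin 3 → F}
    (hv : ∑ i, v (Sum.inl i) * v (Sum.inr i) = 0) : zonal m v ∈ harmonicSubmodule F m := by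
  constructor
  · rw [bihomSubmodule, SetLike.mem_coe, mem_weightedHomogeneousSubmodule]
    have h1 : IsWeightedHomogeneous bidegWeight
        (∑ i, X (Sum.inl i) * C (v (Sum.inr i)) : MvPolynomial (Fin 3 ⊕ Fin 3) F) (1, 0) :=
      IsWeightedHomogeneous.sum _ _ _ fun i _ =>
        (isWeightedHomogeneous_X F bidegWeight (Sum.inl i)).mul
          (isWeightedHomogeneous_C bidegWeight _)
    have h2 : IsWeightedHomogeneous bidegWeight
        (∑ i, X (Sum.inr i) * C (v (Sum.inl i)) : MvPolynomial (Fin 3 ⊕ Fin 3) F) (0, 1) :=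
      IsWeightedHomogeneous.sum _ _ _ fun i _ =>
        (isWeightedHomogeneous_X F bidegWeight (Sum.inr i)).mul
          (isWeightedHomogeneous_C bidegWeight _)
    simpa [zonal] using (h1.pow m).mul (h2.pow m)
  · have a1 : ∀ i : Fin 3, pderiv (Sum.inl i) (∑ i, X (Sum.inl i) * C (v (Sum.inr i)) :
        MvPolynomial (Fin 3 ⊕ Fin 3) F) = C (v (Sum.inr i)) := by
      intro i
      fin_cases i <;> simp [Fin.sum_univ_three, pderiv_X]
    have a2 : ∀ i : Fin 3, pderiv (Sum.inr i) (∑ i, X (Sum.inl i) * C (v (Sum.inr i)) :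
        MvPolynomial (Fin 3 ⊕ Fin 3) F) = 0 := by
      intro i
      fin_cases i <;> simp [Fin.sum_univ_three, pderiv_X]
    have a3 : ∀ i : Fin 3, pderiv (Sum.inl i) (∑ i, X (Sum.inr i) * C (v (Sum.inl i)) :
        MvPolynomial (Fin 3 ⊕ Fin 3) F) = 0 := by
      intro i
      fin_cases i <;> simp [Fin.sum_univ_three, pderiv_X]
    have a4 : ∀ i : Fin 3, pderiv (Sum.inr i) (∑ i, X (Sum.inr i) * C (v (Sum.inl i)) :
        MvPolynomial (Fin 3 ⊕ Fin 3) F) = C (v (Sum.inl i)) := by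
      intro i
      fin_cases i <;> simp [Fin.sum_univ_three, pderiv_X]
    rw [SetLike.mem_coe, LinearMap.mem_ker, laplace_apply, zonal]
    simp only [pderiv_mul, pderiv_pow, a1, a2, a3, a4, pderiv_C, mul_zero, zero_mul, zero_add,
      add_zero, Derivation.map_natCast]
    set A := (∑ i, X (Sum.inl i) * C (v (Sum.inr i)) : MvPolynomial (Fin 3 ⊕ Fin 3) F)
    set B := (∑ i, X (Sum.inr i) * C (v (Sum.inl i)) : MvPolynomial (Fin 3 ⊕ Fin 3) F)
    -- Each mixed derivative is the same polynomial times yᵢηᵢ, so the isotropy of (y,η) kills the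
    -- sum.
    calc _ = ∑ i, (m : MvPolynomial (Fin 3 ⊕ Fin 3) F) * A ^ (m - 1) *
          (m : MvPolynomial (Fin 3 ⊕ Fin 3) F) * B ^ (m - 1) *
          C (v (Sum.inl i) * v (Sum.inr i)) := Finset.sum_congr rfl fun i _ => by
            rw [C_mul]
            ring
    _ = 0 := by rw [← Finset.mul_sum, ← map_sum, hv, map_zero, mul_zero]

/-- In characteristic `2 m + 1` the matrix `((x · η) (ξ · y))^m`, with rows and columns indexed by
isotropic `(x, ξ)` and `(y, η)`, has rank at most `3 m² + 3 m + 1`. -/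
theorem exists_zonal_factorization {m : ℕ} (hm : m ≠ 0) [CharP F (2 * m + 1)] :
    ∃ k ≤ 3 * m ^ 2 + 3 * m + 1, ∃ f g : Fin k → (Fin 3 ⊕ Fin 3 → F) → F,
      ∀ u v : Fin 3 ⊕ Fin 3 → F, ∑ i, u (Sum.inl i) * u (Sum.inr i) = 0 →
        ∑ i, v (Sum.inl i) * v (Sum.inr i) = 0 →
        (∑ i, u (Sum.inl i) * v (Sum.inr i)) ^ m * (∑ i, u (Sum.inr i) * v (Sum.inl i)) ^ m =
          ∑ j, f j u * g j v := by
  classical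
  obtain ⟨d, rfl⟩ := Nat.exists_eq_succ_of_ne_zero hm
  have : CharP F (2 * d + 3) := by assumption
  let U := {u : Fin 3 ⊕ Fin 3 → F // ∑ i, u (Sum.inl i) * u (Sum.inr i) = 0}
  let ev : harmonicSubmodule F (d + 1) →ₗ[F] (U → F) :=
    { toFun := fun f u => eval u.1 f.1
      map_add' := fun f g => by ext; simp
      map_smul' := fun c f => by ext; simp }
  -- Multiples of `pairing F` vanish at every isotropic point.
  have hker : (d + 1) ^ 3 ≤ Module.finrank F (LinearMap.ker ev) := by
    refine (cube_le_finrank_harmonicSubmodule (F := F) d).trans ?_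
    let J : harmonicSubmodule F d →ₗ[F] LinearMap.ker ev :=
      { toFun := fun f => ⟨⟨pairing F * f.1, pairing_mul_mem_harmonic f.2⟩, by
          ext u
          have := u.2
          simp [ev, pairing, this]⟩
        map_add' := fun f g => by ext1; ext1; simp [mul_add]
        map_smul' := fun c f => by ext1; ext1; simp }
    refine LinearMap.finrank_le_finrank_of_injective (f := J) fun a b hab => Subtype.ext ?_
    have h : pairing F * a.1 = pairing F * b.1 :=
      congrArg (fun z => (z.1.1 : MvPolynomial (Fin 3 ⊕ Fin 3) F)) hab
    exact mul_left_cancel₀ pairing_ne_zero h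
  have hrk := ev.finrank_range_add_finrank_ker
  have hle := finrank_harmonicSubmodule_le (F := F) (p := 2 * d + 3) (m := d + 1) (by omega)
  -- The left factors are a basis of the range of evaluation; the right factors are the coordinates
  -- of the zonal functions in it.
  let b := Module.finBasis F (LinearMap.range ev)
  let G : Fin (Module.finrank F (LinearMap.range ev)) → U → F := fun j v =>
    b.repr ⟨ev ⟨zonal (d + 1) v.1, zonal_mem v.2⟩, ⟨_, rfl⟩⟩ j
  refine ⟨Module.finrank F (LinearMap.range ev), ?_,
    fun j u => if hu : ∑ i, u (Sum.inl i) * u (Sum.inr i) = 0 then (b j).1 ⟨u, hu⟩ else 0,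
    fun j v => if hv : ∑ i, v (Sum.inl i) * v (Sum.inr i) = 0 then G j ⟨v, hv⟩ else 0, ?_⟩
  · have : Module.finrank F (LinearMap.range ev) + (d + 1) ^ 3 ≤ (d + 1 + 1) ^ 3 := by omega
    have h2 : (d + 1 + 1) ^ 3 = (d + 1) ^ 3 + (3 * (d + 1) ^ 2 + 3 * (d + 1) + 1) := by ring
    simp only [Nat.succ_eq_add_one]
    omega
  · intro u v hu hv
    have h := congrArg (fun z : LinearMap.range ev => z.1 ⟨u, hu⟩)
      (b.sum_repr ⟨ev ⟨zonal (d + 1) v, zonal_mem hv⟩, ⟨_, rfl⟩⟩)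
    simp only [AddSubmonoidClass.coe_finsetSum, Submodule.coe_smul, Finset.sum_apply, Pi.smul_apply,
      smul_eq_mul] at h
    have h2 : ev ⟨zonal (d + 1) v, zonal_mem hv⟩ ⟨u, hu⟩ =
        (∑ i, u (Sum.inl i) * v (Sum.inr i)) ^ (d + 1) *
          (∑ i, u (Sum.inr i) * v (Sum.inl i)) ^ (d + 1) := by
      simp [ev, zonal]
    rw [Nat.succ_eq_add_one, ← h2, ← h]
    refine Finset.sum_congr rfl fun j _ => ?_
    change G j ⟨v, hv⟩ * (b j).1 ⟨u, hu⟩ =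
      (if hu : ∑ i, u (Sum.inl i) * u (Sum.inr i) = 0 then (b j).1 ⟨u, hu⟩ else 0) *
        (if hv : ∑ i, v (Sum.inl i) * v (Sum.inr i) = 0 then G j ⟨v, hv⟩ else 0)
    rw [dif_pos hu, dif_pos hv, mul_comm]

end Harmonic


/-! ### The Hermitian form -/

section Hermitian

open Matrix

theorem exists_charP_of_card_eq_sq {q : ℕ} (hq : IsPrimePow q) {F : Type*} [Field F] [Finite F]
    (hF : Nat.card F = q ^ 2) : ∃ p e : ℕ, p.Prime ∧ CharP F p ∧ 0 < e ∧ q = p ^ e := by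
  obtain ⟨p, e, hp, he, rfl⟩ := hq
  have hp := hp.nat_prime
  have : Fintype F := Fintype.ofFinite F
  refine ⟨p, e, hp, ?_, he, rfl⟩
  obtain ⟨r, hr⟩ := CharP.exists F
  obtain ⟨n, hr', hn⟩ := FiniteField.card F r
  rw [Nat.card_eq_fintype_card, hn, ← pow_mul] at hF
  have : r ∣ p ^ (e * 2) := hF ▸ dvd_pow_self r n.ne_zero
  rwa [← (Nat.prime_dvd_prime_iff_eq hr' hp).1 (hr'.dvd_of_dvd_pow this)]

theorem exists_involution {q : ℕ} (hq : IsPrimePow q) {F : Type*} [Field F] [Finite F]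
    (hF : Nat.card F = q ^ 2) :
    ∃ σ : F →+* F, (∀ a, σ a = a ^ q) ∧ ∀ a, σ (σ a) = a := by
  obtain ⟨p, e, hp, hpF, -, rfl⟩ := exists_charP_of_card_eq_sq hq hF
  have : Fact p.Prime := ⟨hp⟩
  have : Fintype F := Fintype.ofFinite F
  refine ⟨iterateFrobenius F p e, fun a => iterateFrobenius_def p e a, fun a => ?_⟩
  rw [iterateFrobenius_def, iterateFrobenius_def, ← pow_mul, ← sq, ← hF, Nat.card_eq_fintype_card,
    FiniteField.pow_card]

variable {F : Type*} [Field F] {q : ℕ} {σ : F →+* F}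

theorem hermForm_eq_dotProduct (hσ : ∀ a, σ a = a ^ q) (x y : Fin 3 → F) :
    hermForm q x y = x ⬝ᵥ (σ ∘ y) := by
  simp [hermForm, dotProduct, hσ]

theorem hermForm_swap (hσ : ∀ a, σ a = a ^ q) (hσσ : ∀ a, σ (σ a) = a) (x y : Fin 3 → F) :
    hermForm q y x = σ (hermForm q x y) := by
  simp only [hermForm, map_sum, map_mul, ← hσ, hσσ, mul_comm]

theorem hermForm_add_left (x y z : Fin 3 → F) :
    hermForm q (x + y) z = hermForm q x z + hermForm q y z := by
  simp [hermForm, add_mul, Finset.sum_add_distrib]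

theorem hermForm_smul_left (a : F) (x z : Fin 3 → F) :
    hermForm q (a • x) z = a * hermForm q x z := by
  simp [hermForm, mul_assoc, Finset.mul_sum]

theorem hermForm_add_right (hσ : ∀ a, σ a = a ^ q) (x y z : Fin 3 → F) :
    hermForm q x (y + z) = hermForm q x y + hermForm q x z := by
  simp [hermForm, ← hσ, mul_add, Finset.sum_add_distrib]

theorem hermForm_smul_right (hσ : ∀ a, σ a = a ^ q) (a : F) (x z : Fin 3 → F) :
    hermForm q x (a • z) = σ a * hermForm q x z := by
  simp [hermForm, ← hσ, Finset.mul_sum, mul_left_comm]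

/-- A vector orthogonal to both `x` and `y`. -/
def hermCross (σ : F →+* F) (x y : Fin 3 → F) : Fin 3 → F := (σ ∘ x) ⨯₃ (σ ∘ y)

theorem comp_hermCross (hσσ : ∀ a, σ (σ a) = a) (x y : Fin 3 → F) :
    σ ∘ hermCross σ x y = x ⨯₃ y := by
  ext i
  fin_cases i <;> simp [hermCross, cross_apply, hσσ]

theorem hermForm_hermCross_left (hσ : ∀ a, σ a = a ^ q) (hσσ : ∀ a, σ (σ a) = a)
    (x y : Fin 3 → F) : hermForm q x (hermCross σ x y) = 0 := by
  rw [hermForm_eq_dotProduct hσ, comp_hermCross hσσ, dot_self_cross]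

theorem hermForm_hermCross_right (hσ : ∀ a, σ a = a ^ q) (hσσ : ∀ a, σ (σ a) = a)
    (x y : Fin 3 → F) : hermForm q y (hermCross σ x y) = 0 := by
  rw [hermForm_eq_dotProduct hσ, comp_hermCross hσσ, dot_cross_self]

/-- By the Binet–Cauchy identity this is the Gram determinant of x and y, whose diagonal is zero. -/
theorem hermForm_hermCross_self (hσ : ∀ a, σ a = a ^ q) (hσσ : ∀ a, σ (σ a) = a)
    {x y : Fin 3 → F} (hx : hermForm q x x = 0) (hy : hermForm q y y = 0) :
    hermForm q (hermCross σ x y) (hermCross σ x y) =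
      -(hermForm q x y * σ (hermForm q x y)) := by
  rw [hermForm_eq_dotProduct hσ, comp_hermCross hσσ, hermCross, cross_dot_cross,
    dotProduct_comm _ x, dotProduct_comm _ y, dotProduct_comm _ x, dotProduct_comm _ y,
    ← hermForm_eq_dotProduct hσ, ← hermForm_eq_dotProduct hσ, ← hermForm_eq_dotProduct hσ,
    ← hermForm_eq_dotProduct hσ, hx, hy, hermForm_swap hσ hσσ x y]
  ring

theorem hermCross_ne_zero (hσσ : ∀ a, σ (σ a) = a) {x y : Fin 3 → F}
    (h : LinearIndependent F ![x, y]) : hermCross σ x y ≠ 0 := by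
  intro h0
  refine crossProduct_ne_zero_iff_linearIndependent.2 h ?_
  rw [← comp_hermCross hσσ, h0]
  ext i
  simp

/-- There are no totally isotropic lines. -/
theorem hermForm_ne_zero (hσ : ∀ a, σ a = a ^ q) (hσσ : ∀ a, σ (σ a) = a) {x y : Fin 3 → F}
    (h : LinearIndependent F ![x, y]) (hx : hermForm q x x = 0) (hy : hermForm q y y = 0) :
    hermForm q x y ≠ 0 := by
  intro hxy
  have hyx : hermForm q y x = 0 := by rw [hermForm_swap hσ hσσ x y, hxy, map_zero]
  have hw := hermCross_ne_zero hσσ h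
  -- The orthogonal complement of x and y is a line; if h(x,y) = 0 it would contain both of them.
  have key : ∀ z : Fin 3 → F, hermForm q z x = 0 → hermForm q z y = 0 →
      ∃ a : F, a • hermCross σ x y = z := by
    intro z h1 h2
    have h0 : hermCross σ x y ⨯₃ z = 0 := by
      rw [← cross_anticomm, hermCross, cross_cross_eq_smul_sub_smul',
        ← hermForm_eq_dotProduct hσ, dotProduct_comm, ← hermForm_eq_dotProduct hσ, h1, h2]
      simp
    by_contra hz
    push Not at hz
    exact crossProduct_ne_zero_iff_linearIndependent.2
      ((LinearIndependent.pair_iff' hw).2 hz) h0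
  obtain ⟨a, ha⟩ := key x hx hxy
  obtain ⟨b, hb⟩ := key y hyx hy
  have hx0 : x ≠ 0 := h.ne_zero 0
  have ha0 : a ≠ 0 := by
    rintro rfl
    exact hx0 (by rw [← ha, zero_smul])
  refine (LinearIndependent.pair_iff' hx0).1 h (b / a) ?_
  rw [← hb]
  nth_rewrite 1 [← ha]
  rw [smul_smul, div_mul_cancel₀ _ ha0]

theorem UnitalPoint.linearIndependent {x y : UnitalPoint q F} (hxy : x ≠ y) :
    LinearIndependent F ![x.1.rep, y.1.rep] := by
  rw [LinearIndependent.pair_iff' x.1.rep_nonzero]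
  intro a ha
  apply hxy
  have ha0 : a ≠ 0 := by
    rintro rfl
    exact y.1.rep_nonzero (by rw [← ha, zero_smul])
  apply Subtype.ext
  rw [← x.1.mk_rep, ← y.1.mk_rep, Projectivization.mk_eq_mk_iff']
  exact ⟨a⁻¹, by rw [← ha, smul_smul, inv_mul_cancel₀ ha0, one_smul]⟩

theorem UnitalPoint.hermForm_ne_zero (hσ : ∀ a, σ a = a ^ q) (hσσ : ∀ a, σ (σ a) = a)
    {x y : UnitalPoint q F} (hxy : x ≠ y) : hermForm q x.1.rep y.1.rep ≠ 0 :=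
  _root_.hermForm_ne_zero hσ hσσ (UnitalPoint.linearIndependent hxy) x.2 y.2

/-- Coordinates with respect to the basis that consists of two isotropic vectors and a vector
orthogonal to both. -/
def hermCoord (σ : F →+* F) (x y : Fin 3 → F) (a : F × F × F) : Fin 3 → F :=
  a.1 • x + a.2.1 • y + a.2.2 • hermCross σ x y

theorem hermForm_hermCoord_left (hσ : ∀ a, σ a = a ^ q) (hσσ : ∀ a, σ (σ a) = a)
    {x y : Fin 3 → F} (hx : hermForm q x x = 0) (a : F × F × F) :
    hermForm q (hermCoord σ x y a) x = a.2.1 * σ (hermForm q x y) := by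
  have h := hermForm_swap hσ hσσ x (hermCross σ x y)
  rw [hermForm_hermCross_left hσ hσσ, map_zero] at h
  simp [hermCoord, hermForm_add_left, hermForm_smul_left, h, hx, hermForm_swap hσ hσσ x y]

theorem hermForm_hermCoord_right (hσ : ∀ a, σ a = a ^ q) (hσσ : ∀ a, σ (σ a) = a)
    {x y : Fin 3 → F} (hy : hermForm q y y = 0) (a : F × F × F) :
    hermForm q (hermCoord σ x y a) y = a.1 * hermForm q x y := by
  have h := hermForm_swap hσ hσσ y (hermCross σ x y)
  rw [hermForm_hermCross_right hσ hσσ, map_zero] at h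
  simp [hermCoord, hermForm_add_left, hermForm_smul_left, h, hy]

/-- A trace minus a norm: isotropy becomes a condition on the trace of u = σ(a) b σ(h(x,y)). -/
theorem hermForm_hermCoord_self (hσ : ∀ a, σ a = a ^ q) (hσσ : ∀ a, σ (σ a) = a)
    {x y : Fin 3 → F} (hx : hermForm q x x = 0) (hy : hermForm q y y = 0) (a : F × F × F) :
    hermForm q (hermCoord σ x y a) (hermCoord σ x y a) =
      σ a.1 * a.2.1 * σ (hermForm q x y) + σ (σ a.1 * a.2.1 * σ (hermForm q x y)) -
        hermForm q x y * a.2.2 * σ (hermForm q x y * a.2.2) := by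
  have h1 := hermForm_swap hσ hσσ x (hermCross σ x y)
  have h2 := hermForm_swap hσ hσσ y (hermCross σ x y)
  rw [hermForm_hermCross_left hσ hσσ, map_zero] at h1
  rw [hermForm_hermCross_right hσ hσσ, map_zero] at h2
  simp only [hermCoord, hermForm_add_left, hermForm_smul_left, hermForm_add_right hσ,
    hermForm_smul_right hσ, h1, h2, hx, hy, hermForm_hermCross_left hσ hσσ,
    hermForm_hermCross_right hσ hσσ, hermForm_swap hσ hσσ x y,
    hermForm_hermCross_self hσ hσσ hx hy, map_mul, hσσ]
  ring

theorem hermCoord_bijective [Finite F] (hσ : ∀ a, σ a = a ^ q) (hσσ : ∀ a, σ (σ a) = a)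
    {x y : Fin 3 → F} (h : LinearIndependent F ![x, y]) (hx : hermForm q x x = 0)
    (hy : hermForm q y y = 0) : Function.Bijective (hermCoord σ x y) := by
  have : Fintype F := Fintype.ofFinite F
  classical
  have hH := hermForm_ne_zero hσ hσσ h hx hy
  have hH' : σ (hermForm q x y) ≠ 0 := (map_ne_zero σ).2 hH
  have hw := hermCross_ne_zero hσσ h
  rw [Fintype.bijective_iff_injective_and_card]
  constructor
  · rintro ⟨a, b, c⟩ ⟨a', b', c'⟩ he
    have h1 : hermForm q (hermCoord σ x y (a, b, c)) x =
      hermForm q (hermCoord σ x y (a', b', c')) x := by rw [he]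
    have h2 : hermForm q (hermCoord σ x y (a, b, c)) y =
      hermForm q (hermCoord σ x y (a', b', c')) y := by rw [he]
    rw [hermForm_hermCoord_left hσ hσσ hx, hermForm_hermCoord_left hσ hσσ hx] at h1
    rw [hermForm_hermCoord_right hσ hσσ hy, hermForm_hermCoord_right hσ hσσ hy] at h2
    obtain rfl : b = b' := mul_right_cancel₀ hH' h1
    obtain rfl : a = a' := mul_right_cancel₀ hH h2
    have h3 : c • hermCross σ x y = c' • hermCross σ x y := add_left_cancel he
    rw [smul_left_injective F hw h3]
  · simp [Fintype.card_prod]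
    ring

end Hermitian

/-! ### Traces and norms of the quadratic extension -/

section TraceNorm

/-- The exponent in Euler's criterion, (q² - 1)/2, split so that the criterion can be read off from
u^(q-1). -/
theorem sq_div_two_eq {q : ℕ} (hodd : Odd q) :
    q ^ 2 / 2 = (q - 1) * ((q + 1) / 2) := by
  obtain ⟨k, rfl⟩ := hodd
  have h1 : (2 * k + 1) ^ 2 = 2 * (2 * k * (k + 1)) + 1 := by ring
  have h2 : (2 * k + 1 + 1) / 2 = k + 1 := by omega
  rw [h1, h2, show 2 * k + 1 - 1 = 2 * k by omega]
  omega

theorem pow_sub_one_of_map_eq {F : Type*} [Field F] {q : ℕ} {σ : F →+* F} {u c : F} (hodd : Odd q) (hσ : ∀ a, σ a = a ^ q) (hu : u ≠ 0)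
    (h : σ u = c * u) : u ^ (q - 1) = c := by
  have h1 : u ^ (q - 1) * u = c * u := by
    rw [← pow_succ, Nat.sub_add_cancel hodd.pos, ← hσ, h]
  exact mul_right_cancel₀ hu h1

variable {F : Type*} [Field F] [Fintype F] {q : ℕ}

theorem exists_pow_eq_neg_one (hF : Fintype.card F = q ^ 2) {k l : ℕ}
    (hkl : 2 * k * l = q ^ 2 - 1) : ∃ a : F, a ^ l = -1 := by
  obtain ⟨g, hg⟩ := IsCyclic.exists_generator (α := Fˣ)
  have hord : orderOf g = q ^ 2 - 1 := by
    rw [orderOf_eq_card_of_forall_mem_zpowers hg, Nat.card_units, Nat.card_eq_fintype_card, hF]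
  have hq0 : 1 < q ^ 2 := hF ▸ Fintype.one_lt_card
  refine ⟨((g ^ k : Fˣ) : F), ?_⟩
  have h1 : ((g : F) ^ (k * l)) ^ 2 = 1 := by
    rw [← pow_mul, show k * l * 2 = q ^ 2 - 1 by rw [← hkl]; ring, ← hord, ← Units.val_pow_eq_pow_val,
      pow_orderOf_eq_one, Units.val_one]
  have h2 : (g : F) ^ (k * l) ≠ 1 := by
    intro h
    have h' : g ^ (k * l) = 1 := Units.ext (by simpa using h)
    have := Nat.le_of_dvd (Nat.pos_of_ne_zero ?_) (orderOf_dvd_of_pow_eq_one h')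
    · rw [hord, ← hkl, mul_assoc] at this
      have h3 : k * l ≠ 0 := by
        intro h0
        rw [mul_assoc, h0] at hkl
        omega
      omega
    · intro h0
      rw [mul_assoc, h0] at hkl
      omega
  rw [Units.val_pow_eq_pow_val, ← pow_mul]
  exact (mul_self_eq_one_iff.1 (by rw [← sq]; exact h1)).resolve_left h2

theorem two_ne_zero_of_odd (hodd : Odd q) (hF : Fintype.card F = q ^ 2) : (2 : F) ≠ 0 := by
  intro h
  have h1 : (q : F) ^ 2 = 0 := by
    rw [← Nat.cast_pow, ← hF, FiniteField.cast_card_eq_zero]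
  obtain ⟨k, rfl⟩ := hodd
  rw [Nat.cast_add, Nat.cast_mul, Nat.cast_ofNat, h] at h1
  simp at h1

theorem ringChar_ne_two_of_odd (hodd : Odd q) (hF : Fintype.card F = q ^ 2) : ringChar F ≠ 2 := by
  intro h
  refine two_ne_zero_of_odd hodd hF ?_
  have := ringChar.Nat.cast_ringChar (R := F)
  rw [h] at this
  exact_mod_cast this

theorem one_lt_of_card (hF : Fintype.card F = q ^ 2) : 1 < q := by
  have h := Fintype.one_lt_card (α := F)
  rw [hF] at h
  by_contra hq
  interval_cases q <;> simp at h

theorem exists_skew (hodd : Odd q) (hF : Fintype.card F = q ^ 2)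
    {σ : F →+* F} (hσ : ∀ a, σ a = a ^ q) :
    ∃ ε : F, ε ≠ 0 ∧ σ ε = -ε := by
  obtain ⟨k, rfl⟩ := hodd
  obtain ⟨ε, hε⟩ := exists_pow_eq_neg_one (F := F) hF (k := k + 1) (l := 2 * k) (by
    have : (2 * k + 1) ^ 2 = 2 * (k + 1) * (2 * k) + 1 := by ring
    omega)
  have h0 : (k : ℕ) ≠ 0 := by
    rintro rfl
    have := Fintype.one_lt_card (α := F)
    simp [hF] at this
  refine ⟨ε, ?_, ?_⟩
  · rintro rfl
    simp [h0] at hε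
  · rw [hσ, pow_succ, hε]
    ring

theorem exists_isotropic_pair (hodd : Odd q) (hF : Fintype.card F = q ^ 2) :
    ∃ x y : Fin 3 → F, LinearIndependent F ![x, y] ∧
      hermForm q x x = 0 ∧ hermForm q y y = 0 := by
  obtain ⟨ζ, hζ⟩ : ∃ ζ : F, ζ ^ (q + 1) = -1 := by
    obtain ⟨k, rfl⟩ := hodd
    refine exists_pow_eq_neg_one (F := F) hF (k := k) ?_
    have : (2 * k + 1) ^ 2 = 2 * k * (2 * k + 1 + 1) + 1 := by ring
    omega
  have hζ0 : ζ ≠ 0 := by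
    rintro rfl
    simp at hζ
  have hq0 : q ≠ 0 := hodd.pos.ne'
  have h2 := two_ne_zero_of_odd hodd hF
  refine ⟨![1, ζ, 0], ![1, -ζ, 0], ?_, ?_, ?_⟩
  · rw [LinearIndependent.pair_iff' (fun h => one_ne_zero (congrFun h 0))]
    intro a ha
    have h0 := congrFun ha 0
    have h1 := congrFun ha 1
    simp at h0 h1
    subst h0
    have : 2 * ζ = 0 := by linear_combination h1
    simp [h2, hζ0] at this
  · simp only [hermForm, Fin.sum_univ_three]
    simp [hq0]
    linear_combination hζ
  · simp only [hermForm, Fin.sum_univ_three]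
    simp [hq0, hodd.neg_pow]
    linear_combination hζ

end TraceNorm


/-! ### Character sums over elements of given trace, and over isotropic points. -/

section TraceFibres

variable {F : Type*} [Field F] [Fintype F] [DecidableEq F] {q : ℕ} {σ : F →+* F}

variable (σ) in
/-- The elements of trace `k`. -/
def traceFibre (k : F) : Finset F := Finset.univ.filter fun u => u + σ u = k

theorem mem_traceFibre {k u : F} : u ∈ traceFibre σ k ↔ u + σ u = k := by
  simp [traceFibre]

variable (σ) in
/-- The elements fixed by the involution. -/
def fixedElements : Finset F := Finset.univ.filter fun u => σ u = u

theorem mem_fixedElements {u : F} : u ∈ fixedElements σ ↔ σ u = u := by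
  simp [fixedElements]

/-- Every element is uniquely the sum of a fixed and a skew one. -/
theorem card_fixedElements_mul (hodd : Odd q) (hF : Fintype.card F = q ^ 2)
    (hσσ : ∀ a, σ (σ a) = a) :
    (fixedElements σ).card * (traceFibre σ 0).card = q ^ 2 := by
  have h2 := two_ne_zero_of_odd hodd hF
  rw [← Finset.card_product, ← hF, ← Finset.card_univ]
  refine Finset.card_nbij' (fun a => a.1 + a.2) (fun z => ((z + σ z) / 2, (z - σ z) / 2))
    (by simp) ?_ ?_ ?_
  · intro z _
    simp only [Finset.coe_product, Set.mem_prod, Finset.mem_coe, mem_fixedElements,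
      mem_traceFibre, map_div₀, map_add, map_sub, hσσ, map_ofNat]
    constructor <;> ring
  · rintro ⟨k, u⟩ h
    simp only [Finset.coe_product, Set.mem_prod, Finset.mem_coe, mem_fixedElements,
      mem_traceFibre] at h
    have h3 : σ u = -u := eq_neg_of_add_eq_zero_right h.2
    simp only [map_add, h.1, h3, Prod.mk.injEq]
    constructor <;> (field_simp; ring)
  · intro z _
    field_simp
    ring

theorem card_traceFibre_zero_eq (hodd : Odd q) (hF : Fintype.card F = q ^ 2)
    (hσ : ∀ a, σ a = a ^ q) : (traceFibre σ 0).card = (fixedElements σ).card := by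
  obtain ⟨ε, hε, hs⟩ := exists_skew hodd hF hσ
  refine Finset.card_nbij' (fun u => ε * u) (fun u => ε⁻¹ * u) ?_ ?_ ?_ ?_
  · intro u hu
    simp only [Finset.mem_coe, mem_fixedElements, mem_traceFibre] at hu ⊢
    rw [map_mul, hs, eq_neg_of_add_eq_zero_right hu]
    ring
  · intro u hu
    simp only [Finset.mem_coe, mem_fixedElements, mem_traceFibre] at hu ⊢
    rw [map_mul, map_inv₀, hs, hu, inv_neg]
    ring
  · intro u _
    field_simp
  · intro u _
    field_simp

theorem card_fixedElements (hodd : Odd q) (hF : Fintype.card F = q ^ 2)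
    (hσ : ∀ a, σ a = a ^ q) (hσσ : ∀ a, σ (σ a) = a) : (fixedElements σ).card = q := by
  have h := card_fixedElements_mul hodd hF hσσ
  rw [card_traceFibre_zero_eq hodd hF hσ, ← sq] at h
  exact Nat.pow_left_injective two_ne_zero h

theorem card_traceFibre (hodd : Odd q) (hF : Fintype.card F = q ^ 2)
    (hσ : ∀ a, σ a = a ^ q) (hσσ : ∀ a, σ (σ a) = a) {k : F} (hk : σ k = k) :
    (traceFibre σ k).card = q := by
  have h2 := two_ne_zero_of_odd hodd hF
  rw [← card_fixedElements hodd hF hσ hσσ, ← card_traceFibre_zero_eq hodd hF hσ]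
  refine Finset.card_nbij' (fun u => u - k / 2) (fun u => u + k / 2) ?_ ?_ ?_ ?_
  · intro u hu
    simp only [Finset.mem_coe, mem_traceFibre] at hu ⊢
    rw [map_sub, map_div₀, hk, map_ofNat, ← sub_eq_zero.2 hu]
    field_simp
    ring
  · intro u hu
    have : NeZero (2 : F) := ⟨h2⟩
    simp only [Finset.mem_coe, mem_traceFibre] at hu ⊢
    rw [map_add, map_div₀, hk, map_ofNat, add_add_add_comm, hu, zero_add, add_halves]
  · intro u _
    simp
  · intro u _
    simp

/-- The quadratic character of the nonzero elements of trace zero. -/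
def skewSign (q : ℕ) : ℤ := if q % 4 = 3 then 1 else -1

theorem quadraticChar_fixed (hodd : Odd q) (hF : Fintype.card F = q ^ 2)
    (hσ : ∀ a, σ a = a ^ q) {u : F} (hu : u ≠ 0) (h : σ u = u) : quadraticChar F u = 1 := by
  rw [quadraticChar_one_iff_isSquare hu,
    FiniteField.isSquare_iff (ringChar_ne_two_of_odd hodd hF) hu, hF, sq_div_two_eq hodd, pow_mul,
    pow_sub_one_of_map_eq hodd hσ hu (c := 1) (by rw [h, one_mul]), one_pow]

/-- Here u^(q-1) = -1, so Euler's criterion gives (-1)^((q+1)/2). -/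
theorem quadraticChar_skew (hodd : Odd q) (hF : Fintype.card F = q ^ 2)
    (hσ : ∀ a, σ a = a ^ q) {u : F} (hu : u ≠ 0) (h : σ u = -u) :
    quadraticChar F u = skewSign q := by
  have h1 := FiniteField.isSquare_iff (ringChar_ne_two_of_odd hodd hF) hu
  rw [hF, sq_div_two_eq hodd, pow_mul,
    pow_sub_one_of_map_eq hodd hσ hu (c := -1) (by rw [h, neg_one_mul])] at h1
  rw [skewSign]
  split_ifs with hq
  · rw [quadraticChar_one_iff_isSquare hu, h1, Even.neg_one_pow]
    rw [Nat.even_iff]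
    omega
  · rw [quadraticChar_neg_one_iff_not_isSquare, h1, Odd.neg_one_pow]
    · intro h3
      refine two_ne_zero_of_odd hodd hF ?_
      linear_combination -h3
    · rw [Nat.odd_iff] at hodd ⊢
      omega

theorem sum_quadraticChar_traceFibre_zero (hodd : Odd q) (hF : Fintype.card F = q ^ 2)
    (hσ : ∀ a, σ a = a ^ q) (hσσ : ∀ a, σ (σ a) = a) :
    ∑ u ∈ traceFibre σ 0, quadraticChar F u = (q - 1) * skewSign q := by
  have h0 : (0 : F) ∈ traceFibre σ 0 := mem_traceFibre.2 (by simp)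
  rw [← Finset.add_sum_erase _ _ h0, quadraticChar_zero, zero_add,
    Finset.sum_congr rfl (g := fun _ => skewSign q), Finset.sum_const, Finset.card_erase_of_mem h0,
    card_traceFibre hodd hF hσ hσσ (map_zero σ), nsmul_eq_mul, Nat.cast_sub hodd.pos, Nat.cast_one]
  intro u hu
  rw [Finset.mem_erase, mem_traceFibre] at hu
  exact quadraticChar_skew hodd hF hσ hu.1 (eq_neg_of_add_eq_zero_right hu.2)

theorem sum_quadraticChar_traceFibre_eq (hodd : Odd q) (hF : Fintype.card F = q ^ 2)
    (hσ : ∀ a, σ a = a ^ q) {k : F} (hk0 : k ≠ 0) (hk : σ k = k) :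
    ∑ u ∈ traceFibre σ k, quadraticChar F u = ∑ u ∈ traceFibre σ 1, quadraticChar F u := by
  refine Finset.sum_nbij' (fun u => k⁻¹ * u) (fun u => k * u) ?_ ?_ ?_ ?_ ?_
  · intro u hu
    simp only [mem_traceFibre] at hu ⊢
    rw [map_mul, map_inv₀, hk, ← mul_add, hu, inv_mul_cancel₀ hk0]
  · intro u hu
    simp only [mem_traceFibre] at hu ⊢
    rw [map_mul, hk, ← mul_add, hu, mul_one]
  · intro u _
    field_simp
  · intro u _
    field_simp
  · intro u _
    rw [map_mul, quadraticChar_fixed hodd hF hσ (inv_ne_zero hk0) (by rw [map_inv₀, hk]), one_mul]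

/-- The q - 1 nonzero traces contribute equally, because fixed scalars are squares, and together
they cancel the contribution of trace zero. -/
theorem sum_quadraticChar_traceFibre (hodd : Odd q) (hF : Fintype.card F = q ^ 2)
    (hσ : ∀ a, σ a = a ^ q) (hσσ : ∀ a, σ (σ a) = a) {k : F} (hk0 : k ≠ 0) (hk : σ k = k) :
    ∑ u ∈ traceFibre σ k, quadraticChar F u = -skewSign q := by
  rw [sum_quadraticChar_traceFibre_eq hodd hF hσ hk0 hk]
  have h := quadraticChar_sum_zero (ringChar_ne_two_of_odd hodd hF)
  rw [← Finset.sum_fiberwise_of_maps_to (t := fixedElements σ) (g := fun u => u + σ u)] at h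
  · have h0 : (0 : F) ∈ fixedElements σ := mem_fixedElements.2 (map_zero σ)
    rw [← Finset.add_sum_erase _ _ h0, Finset.sum_congr rfl (s₁ := (fixedElements σ).erase 0)
      (g := fun _ => ∑ u ∈ traceFibre σ 1, quadraticChar F u), Finset.sum_const,
      Finset.card_erase_of_mem h0, card_fixedElements hodd hF hσ hσσ] at h
    · have h1 := sum_quadraticChar_traceFibre_zero hodd hF hσ hσσ
      rw [traceFibre] at h1
      rw [h1, nsmul_eq_mul, Nat.cast_sub hodd.pos, Nat.cast_one, ← mul_add, mul_eq_zero] at h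
      rcases h with h | h
      · have : q = 1 := by
          have : (q : ℤ) = 1 := by linarith
          exact_mod_cast this
        have h2 := Fintype.one_lt_card (α := F)
        simp [hF, this] at h2
      · linarith
    · intro k hk
      rw [Finset.mem_erase, mem_fixedElements] at hk
      exact sum_quadraticChar_traceFibre_eq hodd hF hσ hk.1 hk.2
  · intro u _
    rw [mem_fixedElements, map_add, hσσ, add_comm]

/-- If the first coordinate is 0, the equation forces the third to be 0 and leaves the second free.
Otherwise rescaling the other two gives a trace equal to a norm. -/
theorem sum_triple_eq (hF : Fintype.card F = q ^ 2) (φ : F → ℤ) {H : F} (hH : H ≠ 0) :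
    ∑ a : F × F × F, (if σ a.1 * a.2.1 * σ H + σ (σ a.1 * a.2.1 * σ H) -
      H * a.2.2 * σ (H * a.2.2) = 0 then φ (σ a.1 * a.2.1 * σ H) else 0) =
    q ^ 2 * φ 0 + (q ^ 2 - 1) * ∑ c : F, ∑ u ∈ traceFibre σ (c * σ c), φ u := by
  have hσH : σ H ≠ 0 := (map_ne_zero σ).2 hH
  have h0 : ∑ a : F × F, (if σ 0 * a.1 * σ H + σ (σ 0 * a.1 * σ H) -
      H * a.2 * σ (H * a.2) = 0 then φ (σ 0 * a.1 * σ H) else 0) = q ^ 2 * φ 0 := by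
    have : ∀ c : F, (H * c * σ (H * c) = 0) ↔ c = 0 := by
      intro c
      simp [hH]
    simp only [map_zero, zero_mul, zero_add, zero_sub, neg_eq_zero, this]
    rw [Fintype.sum_prod_type]
    simp [hF]
  have h1 : ∀ a : F, a ≠ 0 → ∑ b : F × F, (if σ a * b.1 * σ H + σ (σ a * b.1 * σ H) -
      H * b.2 * σ (H * b.2) = 0 then φ (σ a * b.1 * σ H) else 0) =
      ∑ c : F, ∑ u ∈ traceFibre σ (c * σ c), φ u := by
    intro a ha
    have hσa : σ a ≠ 0 := (map_ne_zero σ).2 ha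
    rw [Fintype.sum_prod_type, Finset.sum_comm]
    rw [← Equiv.sum_comp (Equiv.mulLeft₀ H hH) (fun c => ∑ u ∈ traceFibre σ (c * σ c), φ u)]
    refine Finset.sum_congr rfl fun c _ => ?_
    rw [traceFibre, Finset.sum_filter]
    refine Eq.trans ?_ (Equiv.sum_comp (Equiv.mulLeft₀ (σ a * σ H) (mul_ne_zero hσa hσH)) _)
    refine Finset.sum_congr rfl fun b _ => ?_
    simp only [Equiv.mulLeft₀_apply, sub_eq_zero]
    rw [show σ a * b * σ H = σ a * σ H * b by ring]
  rw [Fintype.sum_prod_type, ← Finset.add_sum_erase _ _ (Finset.mem_univ (0 : F))]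
  rw [Finset.sum_congr rfl fun a ha => h1 a (Finset.ne_of_mem_erase ha), Finset.sum_const,
    Finset.card_erase_of_mem (Finset.mem_univ _), Finset.card_univ, hF, nsmul_eq_mul,
    Nat.cast_sub (by rw [← hF]; exact Fintype.card_pos)]
  push_cast
  rw [← h0]

theorem sum_norm_traceFibre_one (hodd : Odd q) (hF : Fintype.card F = q ^ 2)
    (hσ : ∀ a, σ a = a ^ q) (hσσ : ∀ a, σ (σ a) = a) :
    ∑ c : F, ∑ _u ∈ traceFibre σ (c * σ c), (1 : ℤ) = q ^ 3 := by
  rw [Finset.sum_congr rfl (g := fun _ => (q : ℤ))]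
  · rw [Finset.sum_const, Finset.card_univ, hF, nsmul_eq_mul]
    push_cast
    ring
  · intro c _
    rw [Finset.sum_const, card_traceFibre hodd hF hσ hσσ (by rw [map_mul, hσσ, mul_comm])]
    simp

theorem sum_norm_traceFibre_quadraticChar (hodd : Odd q) (hF : Fintype.card F = q ^ 2)
    (hσ : ∀ a, σ a = a ^ q) (hσσ : ∀ a, σ (σ a) = a) :
    ∑ c : F, ∑ u ∈ traceFibre σ (c * σ c), quadraticChar F u = -skewSign q * (q ^ 2 - q) := by
  rw [← Finset.add_sum_erase _ _ (Finset.mem_univ (0 : F)), zero_mul,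
    sum_quadraticChar_traceFibre_zero hodd hF hσ hσσ,
    Finset.sum_congr rfl (g := fun _ => -skewSign q), Finset.sum_const,
    Finset.card_erase_of_mem (Finset.mem_univ _), Finset.card_univ, hF, nsmul_eq_mul,
    Nat.cast_sub (by rw [← hF]; exact Fintype.card_pos)]
  · push_cast
    ring
  · intro c hc
    have hc := Finset.ne_of_mem_erase hc
    exact sum_quadraticChar_traceFibre hodd hF hσ hσσ (mul_ne_zero hc ((map_ne_zero σ).2 hc))
      (by rw [map_mul, hσσ, mul_comm])

/-- A sum over the isotropic vectors in terms of two of them. -/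
theorem sum_isotropic_vectors (hF : Fintype.card F = q ^ 2)
    (hσ : ∀ a, σ a = a ^ q) (hσσ : ∀ a, σ (σ a) = a) {x y : Fin 3 → F}
    (h : LinearIndependent F ![x, y]) (hx : hermForm q x x = 0) (hy : hermForm q y y = 0)
    (φ : F → ℤ)
    (hφ : ∀ u, φ (hermForm q x y * σ (hermForm q x y) * u) = φ u) :
    ∑ z : Fin 3 → F, (if hermForm q z z = 0 then
      φ (hermForm q x y * hermForm q y z * hermForm q z x) else 0) =
    q ^ 2 * φ 0 + (q ^ 2 - 1) * ∑ c : F, ∑ u ∈ traceFibre σ (c * σ c), φ u := by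
  rw [← sum_triple_eq hF φ (hermForm_ne_zero hσ hσσ h hx hy),
    ← (Equiv.ofBijective _ (hermCoord_bijective hσ hσσ h hx hy)).sum_comp]
  refine Finset.sum_congr rfl fun a _ => ?_
  rw [Equiv.ofBijective_apply, hermForm_hermCoord_self hσ hσσ hx hy]
  congr 1
  -- The triple product is the norm of h(x,y) times u, and φ ignores that norm.
  rw [hermForm_swap hσ hσσ (hermCoord σ x y a) y, hermForm_hermCoord_left hσ hσσ hx,
    hermForm_hermCoord_right hσ hσσ hy, ← hφ (σ a.1 * a.2.1 * σ (hermForm q x y)), map_mul]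
  congr 1
  ring

/-- Every isotropic point has `q² - 1` representatives. -/
theorem sum_unitalPoint (hF : Fintype.card F = q ^ 2) (hσ : ∀ a, σ a = a ^ q)
    (ψ : (Fin 3 → F) → ℤ) (hψ : ∀ (c : F) z, c ≠ 0 → ψ (c • z) = ψ z) :
    ∑ z : Fin 3 → F, (if hermForm q z z = 0 then ψ z else 0) =
      ψ 0 + (q ^ 2 - 1) * ∑ P : UnitalPoint q F, ψ P.1.rep := by
  have h0 : hermForm q (0 : Fin 3 → F) 0 = 0 := by simp [hermForm]
  rw [← Finset.sum_filter, ← Finset.add_sum_erase _ _ (a := 0) (by simp [h0])]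
  congr 1
  have hu : ((q : ℤ) ^ 2 - 1) = (Fintype.card Fˣ : ℤ) := by
    rw [Fintype.card_units, hF, Nat.cast_sub (by rw [← hF]; exact Fintype.card_pos)]
    push_cast
    rfl
  have h1 : ((q : ℤ) ^ 2 - 1) * ∑ P : UnitalPoint q F, ψ P.1.rep =
      ∑ P : UnitalPoint q F × Fˣ, ψ P.1.1.rep := by
    rw [Fintype.sum_prod_type]
    simp only [Finset.sum_const, Finset.card_univ, nsmul_eq_mul]
    rw [← Finset.mul_sum, hu]
  rw [h1]
  symm
  refine Finset.sum_bij (fun P _ => (P.2 : F) • P.1.1.rep) ?_ ?_ ?_ ?_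
  · rintro ⟨P, c⟩ _
    simp only [Finset.mem_erase, Finset.mem_filter, Finset.mem_univ, true_and]
    refine ⟨smul_ne_zero c.ne_zero P.1.rep_nonzero, ?_⟩
    rw [hermForm_smul_left, hermForm_smul_right hσ, P.2, mul_zero, mul_zero]
  · rintro ⟨P, c⟩ _ ⟨P', c'⟩ _ h
    simp only at h
    have hP : P = P' := by
      apply Subtype.ext
      rw [← P.1.mk_rep, ← P'.1.mk_rep, Projectivization.mk_eq_mk_iff']
      refine ⟨(c : F)⁻¹ * c', ?_⟩
      rw [mul_smul, ← h, smul_smul, inv_mul_cancel₀ c.ne_zero, one_smul]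
    subst hP
    have := smul_left_injective F P.1.rep_nonzero h
    exact Prod.ext rfl (Units.ext this)
  · intro z hz
    simp only [Finset.mem_erase, Finset.mem_filter, Finset.mem_univ, true_and] at hz
    obtain ⟨c, hc⟩ := Projectivization.exists_smul_eq_mk_rep F z hz.1
    have hc' : (c : F) • z = (Projectivization.mk F z hz.1).rep := hc
    refine ⟨(⟨Projectivization.mk F z hz.1, ?_⟩, c⁻¹), Finset.mem_univ _, ?_⟩
    · rw [← hc', hermForm_smul_left, hermForm_smul_right hσ, hz.2, mul_zero, mul_zero]
    · simp only
      rw [← hc', smul_smul, Units.inv_mul, one_smul]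
  · rintro ⟨P, c⟩ _
    exact (hψ _ _ c.ne_zero).symm

theorem card_unitalPoint (hodd : Odd q) (hF : Fintype.card F = q ^ 2)
    (hσ : ∀ a, σ a = a ^ q) (hσσ : ∀ a, σ (σ a) = a) :
    Fintype.card (UnitalPoint q F) = q ^ 3 + 1 := by
  obtain ⟨x, y, h, hx, hy⟩ := exists_isotropic_pair hodd hF
  have h1 := sum_isotropic_vectors hF hσ hσσ h hx hy (fun _ => 1) (fun _ => rfl)
  rw [sum_norm_traceFibre_one hodd hF hσ hσσ,
    sum_unitalPoint hF hσ (fun _ => 1) (fun _ _ _ => rfl)] at h1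
  simp only [Finset.sum_const, Finset.card_univ, nsmul_eq_mul, mul_one] at h1
  have h2 : ((q : ℤ) ^ 2 - 1) * Fintype.card (UnitalPoint q F) = (q ^ 2 - 1) * (q ^ 3 + 1) := by
    linarith
  have h3 : ((q : ℤ) ^ 2 - 1) ≠ 0 := by
    have : (1 : ℤ) < q := by exact_mod_cast one_lt_of_card hF
    nlinarith
  exact_mod_cast mul_left_cancel₀ h3 h2

theorem quadraticChar_norm (hodd : Odd q) (hF : Fintype.card F = q ^ 2)
    (hσ : ∀ a, σ a = a ^ q) (hσσ : ∀ a, σ (σ a) = a) {c : F} (hc : c ≠ 0) :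
    quadraticChar F (c * σ c) = 1 :=
  quadraticChar_fixed hodd hF hσ (mul_ne_zero hc ((map_ne_zero σ).2 hc))
    (by rw [map_mul, hσσ, mul_comm])

/-- The regularity of the unitary two-graph. -/
theorem sum_quadraticChar_triple (hodd : Odd q) (hF : Fintype.card F = q ^ 2)
    (hσ : ∀ a, σ a = a ^ q) (hσσ : ∀ a, σ (σ a) = a) {x y : UnitalPoint q F} (hxy : x ≠ y) :
    ∑ z : UnitalPoint q F, quadraticChar F (hermForm q x.1.rep y.1.rep *
      hermForm q y.1.rep z.1.rep * hermForm q z.1.rep x.1.rep) = -skewSign q * (q ^ 2 - q) := by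
  have hH := UnitalPoint.hermForm_ne_zero hσ hσσ hxy
  have h1 := sum_isotropic_vectors hF hσ hσσ (UnitalPoint.linearIndependent hxy) x.2 y.2
    (quadraticChar F) (fun u => by rw [map_mul, quadraticChar_norm hodd hF hσ hσσ hH, one_mul])
  rw [sum_norm_traceFibre_quadraticChar hodd hF hσ hσσ,
    sum_unitalPoint hF hσ (fun z => quadraticChar F (hermForm q x.1.rep y.1.rep *
      hermForm q y.1.rep z * hermForm q z x.1.rep))] at h1
  · have h0 : hermForm q (0 : Fin 3 → F) x.1.rep = 0 := by simp [hermForm]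
    rw [h0, mul_zero, quadraticChar_zero, mul_zero, zero_add, zero_add] at h1
    have h3 : ((q : ℤ) ^ 2 - 1) ≠ 0 := by
      have : (1 : ℤ) < q := by exact_mod_cast one_lt_of_card hF
      nlinarith
    exact mul_left_cancel₀ h3 h1
  · intro c z hc
    rw [hermForm_smul_left, hermForm_smul_right hσ]
    rw [show ∀ a b d : F, a * (σ c * b) * (c * d) = c * σ c * (a * b * d) by intros; ring, map_mul,
      quadraticChar_norm hodd hF hσ hσσ hc, one_mul]

end TraceFibres


/-! ### The rank of the unitary two-graph in the defining characteristic -/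

section Rank

/-- Induction on e, starting at e = 1 for m ≥ 2 but at e = 2 for m = 1: the inequality fails for q =
3, where 7 + 3 > 9. -/
theorem rank_bound_lt {m e : ℕ} (hm : m ≠ 0) (hq : 3 < (2 * m + 1) ^ e) :
    (3 * m ^ 2 + 3 * m + 1) ^ e + (2 * m + 1) ^ e < ((2 * m + 1) ^ e) ^ 2 := by
  have step : ∀ n, (3 * m ^ 2 + 3 * m + 1) ^ n + (2 * m + 1) ^ n < ((2 * m + 1) ^ n) ^ 2 →
      (3 * m ^ 2 + 3 * m + 1) ^ (n + 1) + (2 * m + 1) ^ (n + 1) < ((2 * m + 1) ^ (n + 1)) ^ 2 := by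
    intro n h
    calc (3 * m ^ 2 + 3 * m + 1) ^ (n + 1) + (2 * m + 1) ^ (n + 1)
        = (3 * m ^ 2 + 3 * m + 1) ^ n * (3 * m ^ 2 + 3 * m + 1) +
            (2 * m + 1) ^ n * (2 * m + 1) := by ring
      _ ≤ (3 * m ^ 2 + 3 * m + 1) ^ n * (2 * m + 1) ^ 2 + (2 * m + 1) ^ n * (2 * m + 1) ^ 2 := by
          gcongr
          · nlinarith
          · nlinarith
      _ = ((3 * m ^ 2 + 3 * m + 1) ^ n + (2 * m + 1) ^ n) * (2 * m + 1) ^ 2 := by ring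
      _ < ((2 * m + 1) ^ n) ^ 2 * (2 * m + 1) ^ 2 := by gcongr
      _ = ((2 * m + 1) ^ (n + 1)) ^ 2 := by ring
  obtain rfl | hm2 : m = 1 ∨ 2 ≤ m := by omega
  · have he : 2 ≤ e := by
      by_contra h
      interval_cases e <;> simp at hq
    induction e, he using Nat.le_induction with
    | base => norm_num
    | succ n hn ih =>
      refine step n (ih ?_)
      calc 3 < (2 * 1 + 1) ^ 2 := by norm_num
        _ ≤ _ := Nat.pow_le_pow_right (by norm_num) hn
  · have he : 1 ≤ e := by
      by_contra h
      interval_cases e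
      simp at hq
    clear hq
    induction e, he using Nat.le_induction with
    | base => nlinarith
    | succ n hn ih => exact step n ih

variable {F : Type*} [Field F]

theorem exists_hermForm_pow_factorization {p e m : ℕ} [Fact p.Prime] [CharP F p]
    (hp : p = 2 * m + 1) (hm : m ≠ 0) {σ : F →+* F} (hσ : ∀ a, σ a = a ^ p ^ e)
    (hσσ : ∀ a, σ (σ a) = a) :
    ∃ (ι : Type) (_ : Fintype ι), Fintype.card ι ≤ (3 * m ^ 2 + 3 * m + 1) ^ e ∧
      ∃ f g : ι → (Fin 3 → F) → F, ∀ x y, hermForm (p ^ e) x x = 0 → hermForm (p ^ e) y y = 0 →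
        hermForm (p ^ e) x y ^ ((p ^ e) ^ 2 / 2) = ∑ i, f i x * g i y := by
  classical
  have : CharP F (2 * m + 1) := hp ▸ inferInstance
  obtain ⟨k, hk, f, g, hfg⟩ := exists_zonal_factorization (F := F) hm
  let d : (Fin 3 → F) → Fin 3 ⊕ Fin 3 → F := fun x => Sum.elim x (σ ∘ x)
  refine ⟨Fin e → Fin k, inferInstance, ?_, fun φ x => ∏ j : Fin e, f (φ j) (d x) ^ p ^ (j : ℕ),
    fun φ y => ∏ j : Fin e, g (φ j) (d y) ^ p ^ (j : ℕ), ?_⟩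
  · simpa using Nat.pow_le_pow_left hk e
  · intro x y hx hy
    have hd : ∀ z : Fin 3 → F, ∀ w : Fin 3 → F,
        ∑ i, d z (Sum.inl i) * d w (Sum.inr i) = hermForm (p ^ e) z w := by
      intro z w
      simp [d, hermForm, hσ]
    have h1 := hfg (d x) (d y) ((hd x x).trans hx) ((hd y y).trans hy)
    have h2 : ∑ i, d x (Sum.inr i) * d y (Sum.inl i) = σ (hermForm (p ^ e) x y) := by
      rw [← hermForm_swap hσ hσσ, ← hd]
      exact Finset.sum_congr rfl fun i _ => mul_comm _ _
    rw [hd, h2, hσ, ← mul_pow, ← pow_succ'] at h1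
    have h3 : (p ^ e) ^ 2 / 2 = (p ^ e + 1) * m * ∑ j : Fin e, p ^ (j : ℕ) := by
      have hS := geom_sum_mul_add (2 * m) e
      rw [← hp, ← Fin.sum_univ_eq_sum_range (fun j => p ^ j)] at hS
      set S := ∑ j : Fin e, p ^ (j : ℕ)
      rw [← hS]
      have : (S * (2 * m) + 1) ^ 2 = 2 * ((S * (2 * m) + 1 + 1) * m * S) + 1 := by ring
      omega
    rw [h3, pow_mul, pow_mul, h1, ← Finset.prod_pow_eq_pow_sum]
    -- Powers by p^j are additive, so the product of e sums of k terms expands into k^e terms.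
    simp only [sum_pow_char_pow, mul_pow]
    rw [Finset.prod_univ_sum, Fintype.piFinset_univ]
    exact Finset.sum_congr rfl fun φ _ => Finset.prod_mul_distrib

/-- A matrix that is switching equivalent to a multiple of `J - I`, of size divisible by the
characteristic, has full rank. -/
theorem card_le_of_factorization {J ι : Type*} [Fintype J] [Fintype ι] (M : J → J → F)
    (s : J → F) (hs : ∀ i, s i ≠ 0) {c : F} (hc : c ≠ 0) (hJ : (Fintype.card J : F) = 0)
    (h0 : ∀ i, M i i = 0) (h1 : ∀ i j, i ≠ j → M i j = c * s i * s j) (f : ι → J → F)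
    (g : ι → J → F) (hfg : ∀ i j, M i j = ∑ a, f a i * g a j) :
    Fintype.card J ≤ Fintype.card ι := by
  classical
  by_contra! hlt
  have hker := LinearMap.ker_ne_bot_of_finrank_lt (f := (Matrix.of g).mulVecLin) (by simpa using hlt)
  obtain ⟨v, hv, hv0⟩ := (Submodule.ne_bot_iff _).1 hker
  apply hv0
  have hv : ∀ a, ∑ j, g a j * v j = 0 := fun a => congrFun hv a
  have hM : ∀ i, ∑ j, M i j * v j = 0 := by
    intro i
    simp only [hfg, Finset.sum_mul]
    rw [Finset.sum_comm]
    simp [mul_assoc, ← Finset.mul_sum, hv]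
  -- With T = ∑ sⱼvⱼ, row i of Mv = 0 says T = sᵢvᵢ; summing over i gives T = |J| T = 0.
  have hT : ∀ i, ∑ j, s j * v j = s i * v i := by
    intro i
    have h2 := hM i
    rw [← Finset.add_sum_erase _ _ (Finset.mem_univ i), h0, zero_mul, zero_add,
      Finset.sum_congr rfl (g := fun j => c * s i * (s j * v j)), ← Finset.mul_sum, mul_eq_zero] at h2
    · have h3 := h2.resolve_left (mul_ne_zero hc (hs i))
      rw [← Finset.add_sum_erase _ _ (Finset.mem_univ i), h3, add_zero]
    · intro j hj
      rw [h1 i j (Finset.ne_of_mem_erase hj).symm]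
      ring
  have hT0 : ∑ j, s j * v j = 0 := by
    rw [Finset.sum_congr rfl fun j _ => (hT j).symm, Finset.sum_const, Finset.card_univ,
      nsmul_eq_mul, hJ, zero_mul]
  ext i
  have := hT i
  rw [hT0, eq_comm, mul_eq_zero] at this
  exact this.resolve_left (hs i)

theorem pow_eq_of_not_coherent [Fintype F] {q : ℕ} (hodd : Odd q) (hF : Fintype.card F = q ^ 2)
    {t : F} (ht : t ≠ 0) (h : ¬ (IsSquare t ↔ q % 4 = 3)) :
    t ^ (q ^ 2 / 2) = if q % 4 = 3 then -1 else 1 := by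
  have h2 := ringChar_ne_two_of_odd hodd hF
  have h3 := FiniteField.isSquare_iff h2 ht
  have h4 := FiniteField.pow_dichotomy h2 ht
  rw [hF] at h3 h4
  rw [h3] at h
  split_ifs with hq <;> tauto

/-- Sets of isotropic points without coherent triples have fewer than `q² - q + 1` points. -/
theorem card_lt_of_not_coherent {q : ℕ} (hq : IsPrimePow q) (hodd : Odd q) (hq3 : 3 < q)
    [Finite F] (hF : Nat.card F = q ^ 2) (Y : Finset (UnitalPoint q F))
    (hY : ∀ x ∈ Y, ∀ y ∈ Y, ∀ z ∈ Y, x ≠ y → y ≠ z → z ≠ x → ¬ TaylorCoherent x y z) :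
    Y.card < q ^ 2 - q + 1 := by
  classical
  by_contra! hcard
  have : Fintype F := Fintype.ofFinite F
  obtain ⟨Z, hZY, hZ⟩ := Finset.exists_subset_card_eq hcard
  obtain ⟨σ, hσ, hσσ⟩ := exists_involution hq hF
  obtain ⟨p, e, hp, hpF, he, hpe⟩ := exists_charP_of_card_eq_sq hq hF
  have : Fact p.Prime := ⟨hp⟩
  have hF' : Fintype.card F = q ^ 2 := by rw [← Nat.card_eq_fintype_card, hF]
  have hpodd : Odd p := by
    rw [hpe] at hodd
    exact Nat.Odd.of_mul_left (n := p ^ (e - 1)) (by rwa [← pow_succ', Nat.sub_add_cancel he])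
  obtain ⟨m, hm⟩ := hpodd
  have hm0 : m ≠ 0 := by
    rintro rfl
    exact hp.one_lt.ne' hm
  obtain ⟨ι, _, hι, f, g, hfg⟩ := exists_hermForm_pow_factorization (F := F) (e := e) hm hm0
    (hpe ▸ hσ) hσσ
  rw [← hpe] at hfg
  have hlt := rank_bound_lt (e := e) hm0 (by rw [← hm, ← hpe]; exact hq3)
  rw [← hm, ← hpe] at hlt
  obtain ⟨y₀, hy₀⟩ : Z.Nonempty := Finset.card_pos.1 (by omega)
  -- Removing y₀ makes the order divisible by p, and the characters of h(y₀,y) provide the switching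
  -- signs.
  have hJ : Fintype.card (Z.erase y₀) = q ^ 2 - q := by
    rw [Fintype.card_coe, Finset.card_erase_of_mem hy₀, hZ, Nat.add_sub_cancel]
  have hexp : q ^ 2 / 2 ≠ 0 := by
    have : 3 * 3 < q ^ 2 := by nlinarith
    omega
  have hle := card_le_of_factorization (J := Z.erase y₀) (ι := ι)
    (fun x y => hermForm q x.1.1.rep y.1.1.rep ^ (q ^ 2 / 2))
    (fun y => hermForm q y₀.1.rep y.1.1.rep ^ (q ^ 2 / 2)) ?_
    (c := if q % 4 = 3 then -1 else 1) ?_ ?_ ?_ ?_ (fun a x => f a x.1.1.rep)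
    (fun a x => g a x.1.1.rep) (fun x y => hfg _ _ x.1.2 y.1.2)
  · omega
  · intro y
    exact pow_ne_zero _ (UnitalPoint.hermForm_ne_zero hσ hσσ (Finset.ne_of_mem_erase y.2).symm)
  · split_ifs <;> simp
  · rw [hJ, Nat.cast_sub (by nlinarith), Nat.cast_pow]
    have : (q : F) = 0 := by
      rw [hpe, Nat.cast_pow, CharP.cast_eq_zero F p, zero_pow he.ne']
    rw [this]
    simp
  · intro x
    rw [x.1.2, zero_pow hexp]
  · intro x y hxy
    have hx := Finset.mem_erase.1 x.2
    have hy := Finset.mem_erase.1 y.2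
    have hxy' : x.1 ≠ y.1 := fun h => hxy (Subtype.ext h)
    have n1 := UnitalPoint.hermForm_ne_zero hσ hσσ hx.1.symm
    have n2 := UnitalPoint.hermForm_ne_zero hσ hσσ hxy'
    have n3 := UnitalPoint.hermForm_ne_zero hσ hσσ hy.1
    have n4 := UnitalPoint.hermForm_ne_zero hσ hσσ hy.1.symm
    have ht := pow_eq_of_not_coherent hodd hF' (mul_ne_zero (mul_ne_zero n1 n2) n3)
      (hY _ (hZY hy₀) _ (hZY hx.2) _ (hZY hy.2) hx.1.symm hxy' hy.1)
    have h2 := ringChar_ne_two_of_odd hodd hF'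
    have d1 := FiniteField.pow_dichotomy h2 n1
    have d3 := FiniteField.pow_dichotomy h2 n4
    rw [hF'] at d1 d3
    -- Symmetry: swapping the arguments raises the value to the power q, which fixes ±1 as q is odd.
    have d4 : hermForm q y.1.1.rep y₀.1.rep ^ (q ^ 2 / 2) =
        hermForm q y₀.1.rep y.1.1.rep ^ (q ^ 2 / 2) := by
      rw [hermForm_swap hσ hσσ y₀.1.rep y.1.1.rep, hσ, ← pow_mul, mul_comm, pow_mul]
      rcases d3 with h | h
      · rw [h, one_pow]
      · rw [h, hodd.neg_one_pow]
    rw [mul_pow, mul_pow, d4] at ht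
    rw [← ht]
    rcases d1 with h | h <;> rcases d3 with h' | h' <;> rw [h, h'] <;> ring

end Rank


/-! ### The spectrum of Taylor graphs -/

section TaylorGraph

open Classical in
/-- The Seidel matrix: `-1` for edges and `1` for pairs of distinct nonadjacent vertices. -/
def seidel {V : Type*} (Γ : SimpleGraph V) (x y : V) : ℤ :=
  if x = y then 0 else if Γ.Adj x y then -1 else 1

/-! ### Seidel matrices and two-graphs. -/

section Seidel

variable {V : Type*} (Γ : SimpleGraph V)

theorem seidel_self (x : V) : seidel Γ x x = 0 := by simp [seidel]

theorem seidel_comm (x y : V) : seidel Γ x y = seidel Γ y x := by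
  rcases eq_or_ne x y with rfl | h
  · rfl
  · rw [seidel, seidel, if_neg h, if_neg h.symm]
    by_cases ha : Γ.Adj x y
    · rw [if_pos ha, if_pos ha.symm]
    · rw [if_neg ha, if_neg fun hb => ha hb.symm]

theorem seidel_mul_self {x y : V} (h : x ≠ y) : seidel Γ x y * seidel Γ x y = 1 := by
  rw [seidel, if_neg h]
  split_ifs <;> rfl

theorem oddTriple_iff_seidel {x y z : V} (hxy : x ≠ y) (hyz : y ≠ z) (hzx : z ≠ x) :
    OddTriple Γ x y z ↔ seidel Γ x y * seidel Γ y z * seidel Γ z x = -1 := by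
  classical
  have h : ({s(x, y), s(y, z), s(z, x)} ∩ Γ.edgeSet : Set (Sym2 V)) =
      ((({s(x, y), s(y, z), s(z, x)} : Finset (Sym2 V)).filter (· ∈ Γ.edgeSet) : Finset _) :
        Set (Sym2 V)) := by
    ext
    simp
  have h1 : s(x, y) ∉ ({s(y, z), s(z, x)} : Finset (Sym2 V)) := by
    simp [hxy, hyz, hzx.symm]
  have h2 : s(y, z) ∉ ({s(z, x)} : Finset (Sym2 V)) := by
    simp [hxy.symm, hyz]
  rw [OddTriple, h, Set.ncard_coe_finset, Finset.card_filter, Finset.sum_insert h1,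
    Finset.sum_insert h2, Finset.sum_singleton, seidel, seidel, seidel, if_neg hxy, if_neg hyz,
    if_neg hzx]
  simp only [SimpleGraph.mem_edgeSet]
  split_ifs <;> decide

theorem not_oddTriple_of_isIndepSet {Y : Set V} (hY : Γ.IsIndepSet Y) {x y z : V} (hx : x ∈ Y)
    (hy : y ∈ Y) (hz : z ∈ Y) (hxy : x ≠ y) (hyz : y ≠ z) (hzx : z ≠ x) :
    ¬ OddTriple Γ x y z := by
  rw [oddTriple_iff_seidel Γ hxy hyz hzx, seidel, seidel, seidel, if_neg hxy, if_neg hyz,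
    if_neg hzx, if_neg (hY hx hy hxy), if_neg (hY hy hz hyz), if_neg (hY hz hx hzx)]
  decide

open Classical in
theorem sum_seidel [Fintype V] {k : ℕ} (hk : Γ.IsRegularOfDegree k) (x : V) :
    ∑ y, seidel Γ x y = Fintype.card V - 1 - 2 * k := by
  have h : ∀ y, seidel Γ x y = 1 - (if x = y then 1 else 0) - 2 * (if Γ.Adj x y then 1 else 0) := by
    intro y
    rw [seidel]
    split_ifs with h1 h2
    · subst h1
      exact absurd h2 (Γ.loopless.irrefl x)
    all_goals norm_num
  have hd : (∑ y, (if Γ.Adj x y then 1 else 0) : ℤ) = k := by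
    rw [← hk x, ← SimpleGraph.card_neighborFinset_eq_degree, Finset.sum_boole]
    congr 2
    ext
    simp
  rw [Finset.sum_congr rfl fun y _ => h y, Finset.sum_sub_distrib, Finset.sum_sub_distrib,
    ← Finset.mul_sum, hd]
  simp

end Seidel

/-! ### The quadratic equation of the Seidel matrix and the resulting eigenvalue. -/

variable {F : Type*} [Field F] [Fintype F] [DecidableEq F] {q : ℕ} {σ : F →+* F}
  {Γ : SimpleGraph (UnitalPoint q F)}

theorem seidel_triple (hσ : ∀ a, σ a = a ^ q) (hσσ : ∀ a, σ (σ a) = a)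
    (hΓ : IsTaylorGraph q F Γ) {x y z : UnitalPoint q F} (hxy : x ≠ y) (hyz : y ≠ z)
    (hzx : z ≠ x) :
    seidel Γ x y * seidel Γ y z * seidel Γ z x = -skewSign q * quadraticChar F
      (hermForm q x.1.rep y.1.rep * hermForm q y.1.rep z.1.rep * hermForm q z.1.rep x.1.rep) := by
  have h1 := hΓ.twoGraph_eq x y z hxy hyz hzx
  have ht := mul_ne_zero (mul_ne_zero (UnitalPoint.hermForm_ne_zero hσ hσσ hxy)
    (UnitalPoint.hermForm_ne_zero hσ hσσ hyz)) (UnitalPoint.hermForm_ne_zero hσ hσσ hzx)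
  rw [oddTriple_iff_seidel Γ hxy hyz hzx, TaylorCoherent, ← quadraticChar_one_iff_isSquare ht] at h1
  have h2 : seidel Γ x y * seidel Γ y z * seidel Γ z x = 1 ∨
      seidel Γ x y * seidel Γ y z * seidel Γ z x = -1 := by
    rw [seidel, seidel, seidel, if_neg hxy, if_neg hyz, if_neg hzx]
    split_ifs <;> decide
  rw [skewSign]
  split_ifs with hq
  · rcases h2 with h | h <;> rcases quadraticChar_dichotomy ht with h' | h' <;>
      simp [h, h', hq] at h1 ⊢
  · rcases h2 with h | h <;> rcases quadraticChar_dichotomy ht with h' | h' <;>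
      simp [h, h', hq] at h1 ⊢

theorem sum_seidel_mul_self (hodd : Odd q) (hF : Fintype.card F = q ^ 2)
    (hσ : ∀ a, σ a = a ^ q) (hσσ : ∀ a, σ (σ a) = a) (x : UnitalPoint q F) :
    ∑ z, seidel Γ x z * seidel Γ z x = q ^ 3 := by
  classical
  rw [← Finset.add_sum_erase _ _ (Finset.mem_univ x), seidel_self, zero_mul, zero_add,
    Finset.sum_congr rfl (g := fun _ => 1), Finset.sum_const,
    Finset.card_erase_of_mem (Finset.mem_univ x), Finset.card_univ,
    card_unitalPoint hodd hF hσ hσσ]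
  · simp
  · intro z hz
    rw [seidel_comm Γ z x]
    exact seidel_mul_self Γ (Finset.ne_of_mem_erase hz).symm

/-- Multiplication by S(x,y) = ±1 turns the entry of S² into a sum over triples. With the diagonal
entries q³ this says (S - q²)(S + q) = 0. -/
theorem sum_seidel_mul (hodd : Odd q) (hF : Fintype.card F = q ^ 2)
    (hσ : ∀ a, σ a = a ^ q) (hσσ : ∀ a, σ (σ a) = a) (hΓ : IsTaylorGraph q F Γ)
    {x y : UnitalPoint q F} (hxy : x ≠ y) :
    ∑ z, seidel Γ x z * seidel Γ z y = (q ^ 2 - q) * seidel Γ x y := by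
  have h1 : seidel Γ x y * ∑ z, seidel Γ x z * seidel Γ z y = q ^ 2 - q := by
    have hs : skewSign q * skewSign q = 1 := by
      rw [skewSign]
      split_ifs <;> rfl
    have h2 := sum_quadraticChar_triple hodd hF hσ hσσ hxy
    calc seidel Γ x y * ∑ z, seidel Γ x z * seidel Γ z y
        = ∑ z : UnitalPoint q F, -skewSign q * quadraticChar F (hermForm q x.1.rep y.1.rep *
            hermForm q y.1.rep z.1.rep * hermForm q z.1.rep x.1.rep) := by
          rw [Finset.mul_sum]
          refine Finset.sum_congr rfl fun z _ => ?_
          rcases eq_or_ne y z with rfl | hyz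
          · rw [y.2]
            simp [seidel_self]
          rcases eq_or_ne z x with rfl | hzx
          · rw [z.2]
            simp [seidel_self]
          rw [← seidel_triple hσ hσσ hΓ hxy hyz hzx, seidel_comm Γ x z, seidel_comm Γ z y]
          ring
      _ = q ^ 2 - q := by
          rw [← Finset.mul_sum, h2]
          linear_combination ((q : ℤ) ^ 2 - q) * hs
  rw [← h1]
  linear_combination (-∑ z, seidel Γ x z * seidel Γ z y) * seidel_mul_self Γ hxy

open Classical in
/-- The least eigenvalue of a Taylor graph is at most `-(q² + 1)/2`. -/
theorem IsTaylorGraph.hasEigenvalue (hodd : Odd q) (hF : Fintype.card F = q ^ 2)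
    (hσ : ∀ a, σ a = a ^ q) (hσσ : ∀ a, σ (σ a) = a) (hΓ : IsTaylorGraph q F Γ) :
    Module.End.HasEigenvalue (Matrix.toLin' (Γ.adjMatrix ℝ)) (-((q : ℝ) ^ 2 + 1) / 2) := by
  have hcard := card_unitalPoint hodd hF hσ hσσ
  obtain ⟨x₀⟩ : Nonempty (UnitalPoint q F) := Fintype.card_pos_iff.1 (by omega)
  have hq0 : (q : ℝ) ≠ 0 := by exact_mod_cast hodd.pos.ne'
  have hk : ((q * (q ^ 2 + 1) / 2 : ℕ) : ℤ) * 2 = q * (q ^ 2 + 1) := by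
    have h2 : 2 ∣ q * (q ^ 2 + 1) := (hodd.pow.add_one.mul_left q).two_dvd
    exact_mod_cast Nat.div_mul_cancel h2
  -- The column of S + q at x₀. It sums to 0, since the row sums of S are q³ - q(q² + 1) = -q.
  let f : UnitalPoint q F → ℤ := fun y => seidel Γ y x₀ + if y = x₀ then (q : ℤ) else 0
  have hf0 : ∑ y, f y = 0 := by
    have h := sum_seidel Γ hΓ.regular x₀
    rw [hcard] at h
    simp only [f]
    rw [Finset.sum_add_distrib, Finset.sum_congr rfl fun y _ => seidel_comm Γ y x₀, h]
    simp only [Finset.sum_ite_eq', Finset.mem_univ, if_true]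
    push_cast at hk ⊢
    linarith
  have hfS : ∀ x, ∑ y, seidel Γ x y * f y = q ^ 2 * f x := by
    intro x
    simp only [f, mul_add, Finset.sum_add_distrib, mul_ite, mul_zero, Finset.sum_ite_eq',
      Finset.mem_univ, if_true]
    rcases eq_or_ne x x₀ with rfl | hx
    · rw [sum_seidel_mul_self hodd hF hσ hσσ, seidel_self]
      simp
      ring
    · rw [sum_seidel_mul hodd hF hσ hσσ hΓ hx, if_neg hx]
      ring
  refine Module.End.hasEigenvalue_of_hasEigenvector (x := fun y => (f y : ℝ)) ⟨?_, ?_⟩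
  · rw [Module.End.mem_eigenspace_iff]
    ext x
    rw [Matrix.toLin'_apply, Matrix.mulVec, dotProduct, Pi.smul_apply, smul_eq_mul]
    -- The adjacency matrix is (J - I - S)/2.
    have hA : ∀ y, Γ.adjMatrix ℝ x y * (f y : ℝ) = (((f y : ℤ) : ℝ) -
        (if x = y then (f y : ℝ) else 0) - ((seidel Γ x y * f y : ℤ) : ℝ)) / 2 := by
      intro y
      rw [SimpleGraph.adjMatrix_apply, seidel]
      split_ifs with h1 h2 h2
      · subst h2
        exact absurd h1 (Γ.loopless.irrefl x)
      all_goals push_cast; ring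
    rw [Finset.sum_congr rfl fun y _ => hA y, ← Finset.sum_div, Finset.sum_sub_distrib,
      Finset.sum_sub_distrib, ← Int.cast_sum, ← Int.cast_sum, hf0, hfS]
    simp
    ring
  · intro h
    have := congrFun h x₀
    simp [f, seidel_self, hq0] at this

end TaylorGraph

end

theorem mainTheorem5 (q : ℕ) (hq : IsPrimePow q) (hodd : Odd q) (hq3 : 3 < q)
    (F : Type*) [Field F] [Finite F] (hF : Nat.card F = q ^ 2)
    (Γ : SimpleGraph (UnitalPoint q F)) (hΓ : IsTaylorGraph q F Γ) :
    ¬ ∃ Y : Finset (UnitalPoint q F), IsDelsarteCoclique Γ Y := by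
  classical
  rintro ⟨Y, hY, k, e, hk, he, hcard⟩
  have : Fintype F := Fintype.ofFinite F
  have hF' : Fintype.card F = q ^ 2 := by rw [← Nat.card_eq_fintype_card, hF]
  obtain ⟨σ, hσ, hσσ⟩ := exists_involution hq hF
  have hv := card_unitalPoint hodd hF' hσ hσσ
  obtain ⟨x₀⟩ : Nonempty (UnitalPoint q F) := Fintype.card_pos_iff.1 (by omega)
  -- An upper bound for e is enough, as ve/(e - k) grows when the negative number e decreases.
  have hle := he.2 (hΓ.hasEigenvalue hodd hF' hσ hσσ)
  have hk2 : (k : ℝ) * 2 = q * (q ^ 2 + 1) := by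
    rw [← hk x₀, hΓ.regular x₀]
    have h2 : 2 ∣ q * (q ^ 2 + 1) := (hodd.pow.add_one.mul_left q).two_dvd
    exact_mod_cast Nat.div_mul_cancel h2
  have hq1 : (3 : ℝ) < q := by exact_mod_cast hq3
  have hlt := card_lt_of_not_coherent hq hodd hq3 hF Y fun x hx y hy z hz hxy hyz hzx hc =>
    not_oddTriple_of_isIndepSet Γ hY hx hy hz hxy hyz hzx
      ((hΓ.twoGraph_eq x y z hxy hyz hzx).2 hc)
  have hlt' : (Y.card : ℝ) < q ^ 2 - q + 1 := by
    have h : Y.card + q < q ^ 2 + 1 := by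
      have : q ≤ q ^ 2 := by nlinarith
      omega
    have h' : (Y.card : ℝ) + q < q ^ 2 + 1 := by exact_mod_cast h
    linarith
  have hneg : e - k < 0 := by
    have : (0 : ℝ) ≤ k := Nat.cast_nonneg k
    nlinarith
  rw [hcard, hv, div_lt_iff_of_neg hneg] at hlt'
  push_cast at hlt'
  -- Since q³ + 1 = (q + 1)(q² - q + 1), `hlt'` amounts to q(q² - q + 1)e > -(q² - q + 1)k, which
  -- contradicts the bound on e.
  have hpos : 0 < (q : ℝ) * (q ^ 2 - q + 1) := by nlinarith
  have h1 : e * 2 ≤ -((q : ℝ) ^ 2 + 1) := by linarith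
  have h2 := mul_le_mul_of_nonneg_left h1 hpos.le
  have h3 : ((q : ℝ) ^ 2 - q + 1) * (k * 2) = (q ^ 2 - q + 1) * (q * (q ^ 2 + 1)) := by rw [hk2]
  nlinarith
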